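/- Let $k$ be a field of characteristic different from $2$, let $n>2$, and let $\mathfrak g$ be an $n$-Filippov algebra over $k$ with $\dim_k\mathfrak g\ge n$: a $k$-vector space (possibly infinite-dimensional) with an $n$-linear bracket that vanishes whenever two arguments coincide and satisfies $$[[x_1,\dots,x_n],y_1,\dots,y_{n-1}]=\sum_{i=1}^n[x_1,\dots,[x_i,y_1,\dots,y_{n-1}],\dots,x_n].$$ Let $D=\mathfrak g^{\otimes(n-1)}$ and $L=\mathfrak g^{\wedge(n-1)}$, with the canonical projection $D\to L$. For $b=b_1\otimes\dots\otimes b_{n-1}\in D$ (or $b=b_1\wedge\dots\wedge b_{n-1}\in L$) write $x\cdot b=[x,b_1,\dots,b_{n-1}]$ for $x\in\mathfrak g$, and extend $x\mapsto x\cdot b$ to $D$ and to $L$ as a derivation, $(a_1\otimes\dots\otimes a_{n-1})\cdot b=\sum_i a_1\otimes\dots\otimes (a_i\cdot b)\otimes\dots\otimes a_{n-1}$ (and likewise with $\wedge$). With $[a,b]=a\cdot b$, both $D$ and $L$ are Leibniz algebras. For $\mathfrak h\in\{D,L\}$ and a space $A$ on which $\mathfrak h$ acts as above, let $CL_*(\mathfrak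 h,A)$ be the chain complex with $CL_i(\mathfrak h,A)=A\otimes\mathfrak h^{\otimes i}$, $i\ge0$, and $$d(v\otimes h_1\otimes\dots\otimes h_i)=\sum_{1\le j\le i}(-1)^{j+1}\Big(v\cdot h_j\otimes h_1\otimes\dots\widehat{h_j}\dots\otimes h_i+\sum_{1\le l<j}v\otimes h_1\otimes\dots\otimes[h_l,h_j]\otimes\dots\widehat{h_j}\dots\otimes h_i\Big).$$ Let ${}_nHL_*(\mathfrak g;k)$ be the homology of $CL_*(D,\mathfrak g)$. Let ${}_nH^{rel}_*(\mathfrak g)$ be the homology of the complex with terms $${}_nC^{rel}_i(\mathfrak g)=\ker\big(\mathfrak g\otimes D^{\otimes(i+1)}\to\mathfrak g\otimes L^{\otimes(i+1)}\big),\qquad i\ge0,$$ and boundary restricted from $CL_{*+1}(D,\mathfrak g)$, and let ${}_nHD_*(\mathfrak g)$ be the homology of the subcomplex ${}_nDR_*(\mathfrak g)$ of $CL_*(L,D)$ with ${}_nDR_i(\mathfrak g)=\ker(D\otimes L^{\otimes i}\to L^{\otimes(i+1)})$, $i\ge 0$. Then the subspaces $$F^p_{i-p}=\mathfrak g\otimes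 D^{\otimes(i-p)}\otimes\ker\big(D^{\otimes(p+1)}\to L^{\otimes(p+1)}\big)\subseteq{}_nC^{rel}_i(\mathfrak g),\qquad 0\le p\le i$$ (completed by $0$ for $p<0$ and by ${}_nC^{rel}_i(\mathfrak g)$ for $p\ge i$) form an increasing filtration of ${}_nC^{rel}_*(\mathfrak g)$ by subcomplexes. The spectral sequence of this filtered complex is a first quadrant homological spectral sequence, with $d^t$ on the page $E^t$ of bidegree $(-t,t-1)$, and it converges to ${}_nH^{rel}_*(\mathfrak g)$: for every $(r,s)$ the terms $E^t_{r,s}$ are stable for large $t$, and the stable value is isomorphic to the $r$-th graded piece of ${}_nH^{rel}_{r+s}(\mathfrak g)$ for the induced filtration, which is finite in each degree. Its second page is $$E^2_{r,s}\cong{}_nHL_s(\mathfrak g;k)\otimes{}_nHD_r(\mathfrak g),\qquad r\ge0,\ s\ge0.$$ -/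

import Mathlib

open scoped TensorProduct
open CategoryTheory

universe u

noncomputable section

namespace LeibnizHomology

variable {k : Type u} [CommRing k]

/-- A (right) Leibniz algebra structure on the `k`-module `h`. -/
structure LeibnizAlgebra (k : Type u) [CommRing k] (h : Type u) [AddCommGroup h] [Module k h] where
  bracket : h →ₗ[k] h →ₗ[k] h
  leibniz : ∀ x y z : h,
    bracket (bracket x y) z = bracket (bracket x z) y + bracket x (bracket y z)

/-- A co-representation of a Leibniz algebra: a left action `[x, m] = left x m` and a right action
`[m, x] = right m x` subject to the three standard axioms. -/
structure CoRepresentation {h : Type u} [AddCommGroup h] [Module k h] (H : LeibnizAlgebra k h)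
    (M : Type u) [AddCommGroup M] [Module k M] where
  left : h →ₗ[k] M →ₗ[k] M
  right : M →ₗ[k] h →ₗ[k] M
  left_bracket : ∀ (x y : h) (m : M),
    left (H.bracket x y) m = left x (left y m) - left y (left x m)
  left_right : ∀ (x y : h) (m : M),
    left y (right m x) = right (left y m) x - right m (H.bracket x y)
  right_right : ∀ (x y : h) (m : M),
    right (right m x) y = right m (H.bracket x y) - right (left y m) x

/-- The module `A ⊗ h^{⊗ n}`, bracketed to the left: `((A ⊗ h) ⊗ h) ⊗ ⋯`. -/
def tens (k : Type u) [CommRing k] (A h : Type u) [AddCommGroup A] [Module k A]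
    [AddCommGroup h] [Module k h] : ℕ → ModuleCat.{u} k
  | 0 => ModuleCat.of k A
  | n + 1 => ModuleCat.of k ((tens k A h n) ⊗[k] h)

section Tens

variable {A A' h h' : Type u} [AddCommGroup A] [Module k A] [AddCommGroup A'] [Module k A']
  [AddCommGroup h] [Module k h] [AddCommGroup h'] [Module k h']

/-- The pure tensors `(β, b) = β ⊗ b`, for `β ∈ A ⊗ h^{⊗ n}` and `b ∈ h`. -/
def snoc (k : Type u) [CommRing k] (A h : Type u) [AddCommGroup A] [Module k A]
    [AddCommGroup h] [Module k h] (n : ℕ) :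
    tens k A h n →ₗ[k] h →ₗ[k] tens k A h (n + 1) :=
  TensorProduct.mk k (tens k A h n) h

/-- The linear map on `A ⊗ h^{⊗ (n+1)}` given by a bilinear map of `(β, b)`. -/
def tensLift {P : Type u} [AddCommGroup P] [Module k P] {n : ℕ}
    (f : tens k A h n →ₗ[k] h →ₗ[k] P) : tens k A h (n + 1) →ₗ[k] P :=
  TensorProduct.lift f

@[simp] theorem tensLift_snoc {P : Type u} [AddCommGroup P] [Module k P] {n : ℕ}
    (f : tens k A h n →ₗ[k] h →ₗ[k] P) (x : tens k A h n) (b : h) :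
    tensLift f (snoc k A h n x b) = f x b := rfl

theorem tens_induction {n : ℕ} {p : tens k A h (n + 1) → Prop} (x : tens k A h (n + 1))
    (zero : p 0) (snoc : ∀ x b, p (snoc k A h n x b)) (add : ∀ x y, p x → p y → p (x + y)) :
    p x :=
  TensorProduct.induction_on (motive := p) x zero snoc add

/-- The map `A ⊗ h^{⊗ n} → A' ⊗ h'^{⊗ n}` induced by `φ : A → A'` and `ψ : h → h'`. -/
def tensMap (φ : A →ₗ[k] A') (ψ : h →ₗ[k] h') : ∀ n, tens k A h n →ₗ[k] tens k A' h' n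
  | 0 => φ
  | n + 1 => tensLift ((snoc k A' h' n).compl₁₂ (tensMap φ ψ n) ψ)

@[simp] theorem tensMap_snoc (φ : A →ₗ[k] A') (ψ : h →ₗ[k] h') (n : ℕ) (x : tens k A h n)
    (b : h) : tensMap φ ψ (n + 1) (snoc k A h n x b) =
      snoc k A' h' n (tensMap φ ψ n x) (ψ b) := rfl

/-- Concatenation `(A ⊗ h^{⊗ s}) ⊗ (h ⊗ h^{⊗ r}) → A ⊗ h^{⊗ (s + r + 1)}`. -/
def concat (k : Type u) [CommRing k] (A h : Type u) [AddCommGroup A] [Module k A]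
    [AddCommGroup h] [Module k h] (s : ℕ) :
    ∀ r, tens k A h s →ₗ[k] tens k h h r →ₗ[k] tens k A h (s + r + 1)
  | 0 => snoc k A h s
  | r + 1 => LinearMap.rTensorHom h ∘ₗ concat k A h s r

@[simp] theorem concat_succ_snoc (s r : ℕ) (x : tens k A h s) (w : tens k h h r) (b : h) :
    concat k A h s (r + 1) x (snoc k h h r w b) =
      snoc k A h (s + r + 1) (concat k A h s r x w) b := rfl

theorem tensMap_concat (φ : A →ₗ[k] A') (ψ : h →ₗ[k] h') (s r : ℕ)
    (x : tens k A h s) (w : tens k h h r) :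
    tensMap φ ψ (s + r + 1) (concat k A h s r x w) =
      concat k A' h' s r (tensMap φ ψ s x) (tensMap ψ ψ r w) := by
  induction r with
  | zero => rfl
  | succ r ih =>
    induction w using tens_induction with
    | zero => simp only [map_zero]
    | add a b ha hb => simp only [map_add, ha, hb]
    | snoc a b =>
      rw [concat_succ_snoc, tensMap_snoc, concat_succ_snoc, ← ih]
      rfl

variable {H : LeibnizAlgebra k h} {H' : LeibnizAlgebra k h'}

/-- The left action of `h` on `A ⊗ h^{⊗ n}`:
`[g, (β, b)] = ([g, β], b) - (β, [b, g])`. -/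
def leftAct (M : CoRepresentation H A) : ∀ n, h →ₗ[k] Module.End k (tens k A h n)
  | 0 => M.left
  | n + 1 => LinearMap.rTensorHom h ∘ₗ leftAct M n - LinearMap.lTensorHom _ ∘ₗ H.bracket.flip

/-- The Loday boundary `d : A ⊗ h^{⊗ (n+1)} → A ⊗ h^{⊗ n}`,
`d(β, b) = (d β, b) + (-1)^(n+1) [b, β]` for `β ∈ A ⊗ h^{⊗ n}` and `b ∈ h` (with `d β = 0` for
`n = 0`); that is,
`d(v, h₁, …, hₘ) = ∑_j (-1)^j ([h_j, v], …, ĥ_j, …) +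
  ∑_{i<j} (-1)^(j+1) (v, …, [h_i, h_j], …, ĥ_j, …)`. -/
def boundary (M : CoRepresentation H A) : ∀ n, tens k A h (n + 1) →ₗ[k] tens k A h n
  | 0 => tensLift (-(leftAct M 0).flip)
  | n + 1 => tensLift (snoc k A h n ∘ₗ boundary M n +
      (-1 : k) ^ (n + 2) • (leftAct M (n + 1)).flip)

theorem leftAct_snoc (M : CoRepresentation H A) (n : ℕ) (g b : h) (x : tens k A h n) :
    leftAct M (n + 1) g (snoc k A h n x b) =
      snoc k A h n (leftAct M n g x) b - snoc k A h n x (H.bracket b g) := rfl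

theorem boundary_zero_snoc (M : CoRepresentation H A) (b : h) (x : tens k A h 0) :
    boundary M 0 (snoc k A h 0 x b) = -leftAct M 0 b x := rfl

theorem boundary_succ_snoc (M : CoRepresentation H A) (n : ℕ) (b : h) (x : tens k A h (n + 1)) :
    boundary M (n + 1) (snoc k A h (n + 1) x b) =
      snoc k A h n (boundary M n x) b + (-1 : k) ^ (n + 2) • leftAct M (n + 1) b x := rfl

theorem leftAct_bracket (M : CoRepresentation H A) (n : ℕ) (a b : h) (x : tens k A h n) :
    leftAct M n (H.bracket a b) x =
      leftAct M n a (leftAct M n b x) - leftAct M n b (leftAct M n a x) := by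
  induction n with
  | zero => exact M.left_bracket a b x
  | succ n ih =>
    induction x using tens_induction with
    | zero => simp only [map_zero, sub_zero]
    | add p q hp hq => simp only [map_add, hp, hq]; abel
    | snoc p q =>
      have h2 : H.bracket q (H.bracket a b) =
          H.bracket (H.bracket q a) b - H.bracket (H.bracket q b) a := by
        rw [H.leibniz q a b]; abel
      simp only [leftAct_snoc, map_sub, ih, h2, LinearMap.sub_apply]
      abel

theorem boundary_leftAct (M : CoRepresentation H A) (n : ℕ) (g : h) (x : tens k A h (n + 1)) :
    boundary M n (leftAct M (n + 1) g x) = leftAct M n g (boundary M n x) := by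
  induction n with
  | zero =>
    induction x using tens_induction with
    | zero => simp only [map_zero]
    | add p q hp hq => simp only [map_add, hp, hq]
    | snoc p q =>
      simp only [leftAct_snoc, map_sub, boundary_zero_snoc, leftAct_bracket, map_neg]
      abel
  | succ n ih =>
    induction x using tens_induction with
    | zero => simp only [map_zero]
    | add p q hp hq => simp only [map_add, hp, hq]
    | snoc p q =>
      rw [leftAct_snoc, map_sub, boundary_succ_snoc, boundary_succ_snoc, boundary_succ_snoc,
        leftAct_bracket, map_add, leftAct_snoc, map_smul, smul_sub, ih]
      abel

theorem boundary_boundary (M : CoRepresentation H A) (n : ℕ) (x : tens k A h (n + 2)) :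
    boundary M n (boundary M (n + 1) x) = 0 := by
  induction n with
  | zero =>
    induction x using tens_induction with
    | zero => simp only [map_zero]
    | add p q hp hq => simp only [map_add, hp, hq, add_zero]
    | snoc p q =>
      rw [boundary_succ_snoc, map_add, boundary_zero_snoc, map_smul, boundary_leftAct]
      norm_num
  | succ n ih =>
    induction x using tens_induction with
    | zero => simp only [map_zero]
    | add p q hp hq => simp only [map_add, hp, hq, add_zero]
    | snoc p q =>
      rw [boundary_succ_snoc, map_add, boundary_succ_snoc, map_smul, boundary_leftAct, ih,
        map_zero, LinearMap.zero_apply, zero_add, ← add_smul, pow_succ _ (n + 2)]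
      simp

theorem tensMap_leftAct (M : CoRepresentation H A) (M' : CoRepresentation H' A')
    (φ : A →ₗ[k] A') (ψ : h →ₗ[k] h')
    (hψ : ∀ a b, ψ (H.bracket a b) = H'.bracket (ψ a) (ψ b))
    (hφ : ∀ a v, φ (M.left a v) = M'.left (ψ a) (φ v)) (n : ℕ) (g : h) (x : tens k A h n) :
    tensMap φ ψ n (leftAct M n g x) = leftAct M' n (ψ g) (tensMap φ ψ n x) := by
  induction n with
  | zero => exact hφ g x
  | succ n ih =>
    induction x using tens_induction with
    | zero => simp only [map_zero]
    | add p q hp hq => simp only [map_add, hp, hq]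
    | snoc p q => rw [leftAct_snoc, map_sub, tensMap_snoc, tensMap_snoc, tensMap_snoc,
        leftAct_snoc, ih, hψ]

theorem tensMap_boundary (M : CoRepresentation H A) (M' : CoRepresentation H' A')
    (φ : A →ₗ[k] A') (ψ : h →ₗ[k] h')
    (hψ : ∀ a b, ψ (H.bracket a b) = H'.bracket (ψ a) (ψ b))
    (hφ : ∀ a v, φ (M.left a v) = M'.left (ψ a) (φ v)) (n : ℕ) (x : tens k A h (n + 1)) :
    tensMap φ ψ n (boundary M n x) = boundary M' n (tensMap φ ψ (n + 1) x) := by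
  induction n with
  | zero =>
    induction x using tens_induction with
    | zero => simp only [map_zero]
    | add p q hp hq => simp only [map_add, hp, hq]
    | snoc p q =>
      rw [tensMap_snoc, boundary_zero_snoc, boundary_zero_snoc, map_neg,
        tensMap_leftAct M M' φ ψ hψ hφ]
  | succ n ih =>
    induction x using tens_induction with
    | zero => simp only [map_zero]
    | add p q hp hq => simp only [map_add, hp, hq]
    | snoc p q =>
      rw [tensMap_snoc, boundary_succ_snoc, boundary_succ_snoc, map_add, map_smul, tensMap_snoc,
        ih, tensMap_leftAct M M' φ ψ hψ hφ]

/-- The chain complex `CL_*(h, A)`. -/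
def leibnizComplex (M : CoRepresentation H A) : ChainComplex (ModuleCat.{u} k) ℕ :=
  ChainComplex.of (fun n => tens k A h n) (fun n => ModuleCat.ofHom (boundary M n)) (fun n => by
    ext x
    exact boundary_boundary M n x)

end Tens

/-- The complex of submodules `S n ⊆ X n`, with the restriction of `d`. -/
def subComplex (X : ℕ → ModuleCat.{u} k) (d : ∀ n, X (n + 1) →ₗ[k] X n)
    (hd : ∀ n x, d n (d (n + 1) x) = 0) (S : ∀ n, Submodule k (X n))
    (hS : ∀ n, ∀ x ∈ S (n + 1), d n x ∈ S n) : ChainComplex (ModuleCat.{u} k) ℕ :=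
  ChainComplex.of (fun n => ModuleCat.of k (S n))
    (fun n => ModuleCat.ofHom ((d n).restrict (hS n))) (fun n => by
      ext x
      exact hd n x)

/-! ### `n`-ary algebras -/

section NAry

variable {m : ℕ} {g : Type u} [AddCommGroup g] [Module k g]

/-- A Leibniz `n`-algebra structure on `g`, where `n = m + 1`. -/
structure LeibnizNAlgebra (k : Type u) [CommRing k] (m : ℕ) (g : Type u)
    [AddCommGroup g] [Module k g] where
  bracket : MultilinearMap k (fun _ : Fin (m + 1) => g) g
  fundamental : ∀ (x : Fin (m + 1) → g) (y : Fin m → g),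
    bracket (Fin.cons (bracket x) y) =
      ∑ i, bracket (Function.update x i (bracket (Fin.cons (x i) y)))

/-- An `n`-Filippov algebra (`n`-Lie algebra) structure on `g`, where `n = m + 1`: a Leibniz
`n`-algebra whose bracket vanishes as soon as two of its arguments agree. -/
structure FilippovAlgebra (k : Type u) [CommRing k] (m : ℕ) (g : Type u)
    [AddCommGroup g] [Module k g] extends LeibnizNAlgebra k m g where
  bracket_eq_zero : ∀ (x : Fin (m + 1) → g) (i j : Fin (m + 1)),
    x i = x j → i ≠ j → bracket x = 0

variable (k m g) in
/-- `D_n(g) = g^{⊗ (n-1)}`. -/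
abbrev DPow : Type u := PiTensorProduct k (fun _ : Fin m => g)

variable (k m g) in
/-- `L_n(g) = g^{∧ (n-1)}`. -/
abbrev LPow : Type u := ⋀[k]^m g

variable (k m g) in
/-- The canonical projection `D_n(g) → L_n(g)`. -/
def proj : DPow k m g →ₗ[k] LPow k m g :=
  PiTensorProduct.lift (exteriorPower.ιMulti k m).toMultilinearMap

@[simp] theorem proj_tprod (a : Fin m → g) :
    proj k m g (PiTensorProduct.tprod k a) = exteriorPower.ιMulti k m a :=
  PiTensorProduct.lift.tprod a

/-- The extension of an endomorphism `f` of `g` to `D_n(g)` as a derivation: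
`a₁ ⊗ ⋯ ⊗ a_{n-1} ↦ ∑ i, a₁ ⊗ ⋯ ⊗ f aᵢ ⊗ ⋯ ⊗ a_{n-1}`. -/
def derD : Module.End k g →ₗ[k] Module.End k (DPow k m g) where
  toFun f := ∑ i, PiTensorProduct.map (Function.update (fun _ => LinearMap.id) i f)
  map_add' f f' := by
    simp only [PiTensorProduct.map_update_add, Finset.sum_add_distrib]
  map_smul' c f := by
    simp only [PiTensorProduct.map_update_smul, Finset.smul_sum, RingHom.id_apply]

theorem derD_tprod (f : Module.End k g) (a : Fin m → g) :
    derD f (PiTensorProduct.tprod k a) =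
      ∑ i, PiTensorProduct.tprod k (Function.update a i (f (a i))) := by
  simp only [derD, LinearMap.coe_mk, AddHom.coe_mk, LinearMap.sum_apply, PiTensorProduct.map_tprod]
  refine Finset.sum_congr rfl fun i _ => congrArg _ (funext fun j => ?_)
  by_cases h : j = i
  · subst h; simp
  · simp [h]

theorem derD_lie (f f' : Module.End k g) (x : DPow k m g) :
    derD (f * f' - f' * f) x = derD f (derD f' x) - derD f' (derD f x) := by
  suffices h : derD (f * f' - f' * f) =
      derD (m := m) f ∘ₗ derD f' - derD (m := m) f' ∘ₗ derD f from congrArg (fun t => t x) h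
  ext a
  simp only [LinearMap.compMultilinearMap_apply, LinearMap.sub_apply, LinearMap.comp_apply,
    derD_tprod, map_sum]
  have key : ∀ f f' : Module.End k g,
      ∑ i, ∑ j, PiTensorProduct.tprod k (Function.update (Function.update a i (f' (a i))) j
        (f (Function.update a i (f' (a i)) j))) =
      ∑ i, PiTensorProduct.tprod k (Function.update a i (f (f' (a i)))) +
      ∑ i, ∑ j, if i = j then 0 else PiTensorProduct.tprod k (Function.update
        (Function.update a i (f' (a i))) j (f (a j))) := by
    intro f f'
    rw [← Finset.sum_add_distrib]
    refine Finset.sum_congr rfl fun i _ => ?_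
    rw [← Finset.add_sum_erase _ _ (Finset.mem_univ i),
      ← Finset.add_sum_erase Finset.univ (fun j => if i = j then _ else _) (Finset.mem_univ i)]
    simp only [Function.update_self, Function.update_idem, if_true, zero_add]
    congr 1
    refine Finset.sum_congr rfl fun j hj => ?_
    have hji : j ≠ i := Finset.ne_of_mem_erase hj
    rw [if_neg (Ne.symm hji), Function.update_of_ne hji]
  rw [key, key, Finset.sum_comm (γ := Fin m)]
  have hsymm : (∑ y, ∑ x, if x = y then (0 : DPow k m g) else PiTensorProduct.tprod k
      (Function.update (Function.update a x (f' (a x))) y (f (a y)))) =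
      ∑ i, ∑ j, if i = j then (0 : DPow k m g) else PiTensorProduct.tprod k
        (Function.update (Function.update a i (f (a i))) j (f' (a j))) := by
    refine Finset.sum_congr rfl fun i _ => Finset.sum_congr rfl fun j _ => ?_
    by_cases h : i = j
    · simp [h]
    · rw [if_neg h, if_neg (Ne.symm h), Function.update_comm h]
  rw [hsymm, add_sub_add_right_eq_sub, ← Finset.sum_sub_distrib]
  refine Finset.sum_congr rfl fun i _ => ?_
  rw [MultilinearMap.map_update_sub]
  rfl

/-- The extension of an endomorphism `f` of `g` to `L_n(g)` as a derivation:
`a₁ ∧ ⋯ ∧ a_{n-1} ↦ ∑ i, a₁ ∧ ⋯ ∧ f aᵢ ∧ ⋯ ∧ a_{n-1}`. -/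
def derL : Module.End k g →ₗ[k] Module.End k (LPow k m g) where
  toFun f := exteriorPower.alternatingMapLinearEquiv
    { (proj k m g ∘ₗ derD f).compMultilinearMap (PiTensorProduct.tprod k) with
      map_eq_zero_of_eq' := fun a i j hij hne => by
        change proj k m g (derD f (PiTensorProduct.tprod k a)) = 0
        rw [derD_tprod, map_sum]
        simp only [proj_tprod]
        rw [← Finset.add_sum_erase _ _ (Finset.mem_univ i),
          ← Finset.add_sum_erase _ _ (Finset.mem_erase.2 ⟨hne.symm, Finset.mem_univ j⟩),
          Finset.sum_eq_zero, add_zero]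
        · have hs : Function.update a j (f (a j)) =
              Function.update a i (f (a i)) ∘ Equiv.swap i j := by
            funext l
            simp only [Function.comp_apply]
            by_cases h1 : l = i
            · subst h1
              simp [hne, hne.symm, hij]
            · by_cases h2 : l = j
              · subst h2; simp [hij]
              · rw [Equiv.swap_apply_of_ne_of_ne h1 h2]; simp [h1, h2]
          rw [hs, AlternatingMap.map_swap _ _ hne, add_neg_cancel]
        · intro l hl
          have h2 : l ≠ j := Finset.ne_of_mem_erase hl
          have h1 : l ≠ i := Finset.ne_of_mem_erase (Finset.mem_of_mem_erase hl)
          exact AlternatingMap.map_eq_zero_of_eq _ _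
            (by rw [Function.update_of_ne h1.symm, Function.update_of_ne h2.symm, hij]) hne }
  map_add' f f' := by
    ext a
    simp [map_add]
  map_smul' c f := by
    ext a
    simp

theorem derL_proj (f : Module.End k g) (x : DPow k m g) :
    derL f (proj k m g x) = proj k m g (derD f x) := by
  suffices h : derL f ∘ₗ proj k m g = proj k m g ∘ₗ derD f from congrArg (fun t => t x) h
  ext a
  simp only [LinearMap.compMultilinearMap_apply, LinearMap.comp_apply, proj_tprod]
  simp [derL]

theorem derL_lie (f f' : Module.End k g) (x : LPow k m g) :
    derL (f * f' - f' * f) x = derL f (derL f' x) - derL f' (derL f x) := by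
  suffices h : derL (f * f' - f' * f) =
      derL (m := m) f ∘ₗ derL f' - derL (m := m) f' ∘ₗ derL f from congrArg (fun t => t x) h
  apply exteriorPower.linearMap_ext
  ext1 a
  simp only [LinearMap.compAlternatingMap_apply, LinearMap.sub_apply, LinearMap.comp_apply]
  rw [← proj_tprod, derL_proj, derD_lie, map_sub, derL_proj, derL_proj, derL_proj, derL_proj]

namespace LeibnizNAlgebra

variable (G : LeibnizNAlgebra k m g)

/-- `b₁ ⊗ ⋯ ⊗ b_{n-1} ↦ (x ↦ [x, b₁, …, b_{n-1}])`. -/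
def adD : DPow k m g →ₗ[k] Module.End k g :=
  ((PiTensorProduct.lift (R := k)).toLinearMap ∘ₗ G.bracket.curryLeft).flip

theorem adD_tprod (b : Fin m → g) (x : g) :
    G.adD (PiTensorProduct.tprod k b) x = G.bracket (Fin.cons x b) :=
  PiTensorProduct.lift.tprod b

theorem adD_derD (b c : DPow k m g) :
    G.adD (derD (G.adD c) b) = G.adD c * G.adD b - G.adD b * G.adD c := by
  induction b using PiTensorProduct.induction_on with
  | add p q hp hq => simp only [map_add, hp, hq, mul_add, add_mul]; abel
  | smul_tprod r b =>
    rw [map_smul, map_smul, map_smul, mul_smul_comm, smul_mul_assoc, ← smul_sub]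
    congr 1
    induction c using PiTensorProduct.induction_on with
    | add p q hp hq =>
      simp only [map_add, LinearMap.add_apply, hp, hq, mul_add, add_mul]; abel
    | smul_tprod s c =>
      simp only [map_smul, LinearMap.smul_apply, mul_smul_comm, smul_mul_assoc, ← smul_sub]
      congr 1
      ext x
      rw [derD_tprod, map_sum]
      simp only [LinearMap.sum_apply, LinearMap.sub_apply, Module.End.mul_apply, adD_tprod]
      rw [G.fundamental (Fin.cons x b) c, Fin.sum_univ_succ]
      simp only [Fin.cons_zero, Fin.cons_succ, Fin.update_cons_zero, ← Fin.cons_update]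
      abel

/-- The Leibniz algebra `D_n(g)`, with
`[a₁ ⊗ ⋯ ⊗ a_{n-1}, b] = ∑ i, a₁ ⊗ ⋯ ⊗ [aᵢ, b₁, …, b_{n-1}] ⊗ ⋯ ⊗ a_{n-1}`. -/
def leibnizD : LeibnizAlgebra k (DPow k m g) where
  bracket := (derD ∘ₗ G.adD).flip
  leibniz a b c := by
    simp only [LinearMap.flip_apply, LinearMap.comp_apply, adD_derD, derD_lie]
    abel

/-- `g` as a co-representation of `D_n(g)`:
`[x, b] = [x, b₁, …, b_{n-1}]` and `[b, x] = -[x, b₁, …, b_{n-1}]`. -/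
def coRepD : CoRepresentation G.leibnizD g where
  left := -G.adD
  right := G.adD.flip
  left_bracket b c x := by
    simp only [leibnizD, LinearMap.flip_apply, LinearMap.comp_apply, LinearMap.neg_apply, adD_derD,
      LinearMap.sub_apply, Module.End.mul_apply, map_neg]
    abel
  left_right b c x := by
    simp only [leibnizD, LinearMap.flip_apply, LinearMap.comp_apply, LinearMap.neg_apply, adD_derD,
      LinearMap.sub_apply, Module.End.mul_apply, map_neg]
    abel
  right_right b c x := by
    simp only [leibnizD, LinearMap.flip_apply, LinearMap.comp_apply, LinearMap.neg_apply, adD_derD,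
      LinearMap.sub_apply, Module.End.mul_apply, map_neg]
    abel

/-- Casas' complex `CL_*(D_n(g), g)`; its homology is the Leibniz homology of the
Leibniz `n`-algebra `g` with trivial coefficients. -/
def complexHL : ChainComplex (ModuleCat.{u} k) ℕ := leibnizComplex G.coRepD

end LeibnizNAlgebra

namespace FilippovAlgebra

variable (G : FilippovAlgebra k m g)

/-- The bracket of a Filippov algebra as an alternating map. -/
def altBracket : g [⋀^Fin (m + 1)]→ₗ[k] g :=
  { G.bracket with map_eq_zero_of_eq' := G.bracket_eq_zero }

/-- `b₁ ∧ ⋯ ∧ b_{n-1} ↦ (x ↦ [x, b₁, …, b_{n-1}])`. -/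
def adL : LPow k m g →ₗ[k] Module.End k g :=
  (exteriorPower.alternatingMapLinearEquiv.toLinearMap ∘ₗ G.altBracket.curryLeft).flip

theorem adL_proj (b : DPow k m g) : G.adL (proj k m g b) = G.adD b := by
  suffices h : G.adL ∘ₗ proj k m g = G.adD from congrArg (fun t => t b) h
  ext a x
  simp only [LinearMap.compMultilinearMap_apply, LinearMap.comp_apply, proj_tprod]
  rw [G.adD_tprod]
  simp [adL]
  rfl

theorem adL_derL (b c : LPow k m g) :
    G.adL (derL (G.adL c) b) = G.adL c * G.adL b - G.adL b * G.adL c := by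
  have hs : ∀ y : LPow k m g, ∃ x, proj k m g x = y := by
    intro y
    have : y ∈ LinearMap.range (proj k m g) := by
      have h1 : Submodule.span k (Set.range (exteriorPower.ιMulti k m)) ≤
          LinearMap.range (proj k m g) := by
        rw [Submodule.span_le]
        rintro _ ⟨a, rfl⟩
        exact ⟨_, proj_tprod a⟩
      exact h1 (by rw [exteriorPower.ιMulti_span]; trivial)
    exact this
  obtain ⟨b, rfl⟩ := hs b
  obtain ⟨c, rfl⟩ := hs c
  rw [adL_proj, derL_proj, adL_proj, adL_proj, G.adD_derD]

/-- The Leibniz algebra `L_n(g)`, with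
`[a₁ ∧ ⋯ ∧ a_{n-1}, b] = ∑ i, a₁ ∧ ⋯ ∧ [aᵢ, b₁, …, b_{n-1}] ∧ ⋯ ∧ a_{n-1}`. -/
def leibnizL : LeibnizAlgebra k (LPow k m g) where
  bracket := (derL ∘ₗ G.adL).flip
  leibniz a b c := by
    simp only [LinearMap.flip_apply, LinearMap.comp_apply, adL_derL, derL_lie]
    abel

/-- `g` as a co-representation of `L_n(g)`:
`[x, b] = [x, b₁, …, b_{n-1}]` and `[b, x] = -[x, b₁, …, b_{n-1}]`. -/
def coRepL : CoRepresentation G.leibnizL g where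
  left := -G.adL
  right := G.adL.flip
  left_bracket b c x := by
    simp only [leibnizL, LinearMap.flip_apply, LinearMap.comp_apply, LinearMap.neg_apply, adL_derL,
      LinearMap.sub_apply, Module.End.mul_apply, map_neg]
    abel
  left_right b c x := by
    simp only [leibnizL, LinearMap.flip_apply, LinearMap.comp_apply, LinearMap.neg_apply, adL_derL,
      LinearMap.sub_apply, Module.End.mul_apply, map_neg]
    abel
  right_right b c x := by
    simp only [leibnizL, LinearMap.flip_apply, LinearMap.comp_apply, LinearMap.neg_apply, adL_derL,
      LinearMap.sub_apply, Module.End.mul_apply, map_neg]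
    abel

/-- `D_n(g)` as an anti-symmetric co-representation of `L_n(g)`: the right action is zero and
`[a, b₁ ⊗ ⋯ ⊗ b_{n-1}] = -∑ i, b₁ ⊗ ⋯ ⊗ [bᵢ, a₁, …, a_{n-1}] ⊗ ⋯ ⊗ b_{n-1}`. -/
def coRepLD : CoRepresentation G.leibnizL (DPow k m g) where
  left := derD ∘ₗ (-G.adL)
  right := 0
  left_bracket b c x := by
    simp only [leibnizL, LinearMap.flip_apply, LinearMap.comp_apply, LinearMap.neg_apply, adL_derL,
      ← derD_lie]
    congr 2
    noncomm_ring
  left_right b c x := by simp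
  right_right b c x := by simp

/-- `L_n(g)` as an anti-symmetric co-representation of itself, with left action `-[x, a]`. -/
def coRepLL : CoRepresentation G.leibnizL (LPow k m g) where
  left := derL ∘ₗ (-G.adL)
  right := 0
  left_bracket b c x := by
    simp only [leibnizL, LinearMap.flip_apply, LinearMap.comp_apply, LinearMap.neg_apply, adL_derL,
      ← derL_lie]
    congr 2
    noncomm_ring
  left_right b c x := by simp
  right_right b c x := by simp

theorem proj_bracket (a b : DPow k m g) :
    proj k m g (G.leibnizD.bracket a b) =
      G.leibnizL.bracket (proj k m g a) (proj k m g b) := by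
  change proj k m g (derD (G.adD b) a) = derL (G.adL (proj k m g b)) (proj k m g a)
  rw [adL_proj, derL_proj]

/-- The relative complex, with `C_i = ker (g ⊗ D_n(g)^{⊗ (i+1)} → g ⊗ L_n(g)^{⊗ (i+1)})` and
the boundary of `CL_*(D_n(g), g)`. -/
def complexRel : ChainComplex (ModuleCat.{u} k) ℕ :=
  subComplex (fun i => tens k g (DPow k m g) (i + 1)) (fun i => boundary G.coRepD (i + 1))
    (fun i => boundary_boundary G.coRepD (i + 1))
    (fun i => LinearMap.ker (tensMap (LinearMap.id (R := k) (M := g)) (proj k m g) (i + 1)))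
    (fun i x hx => by
      rw [LinearMap.mem_ker] at hx ⊢
      rw [tensMap_boundary G.coRepD G.coRepL _ _ G.proj_bracket, hx, map_zero]
      intro a v
      change -(G.adD a v) = -(G.adL (proj k m g a) v)
      rw [adL_proj])

/-- The complex with `i`-th term `ker (D_n(g) ⊗ L_n(g)^{⊗ i} → L_n(g)^{⊗ (i+1)})` and the
boundary of `CL_*(L_n(g), D_n(g))`. -/
def complexDR : ChainComplex (ModuleCat.{u} k) ℕ :=
  subComplex (fun i => tens k (DPow k m g) (LPow k m g) i) (fun i => boundary G.coRepLD i)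
    (fun i => boundary_boundary G.coRepLD i)
    (fun i => LinearMap.ker (tensMap (proj k m g) (LinearMap.id (R := k) (M := LPow k m g)) i))
    (fun i x hx => by
      rw [LinearMap.mem_ker] at hx ⊢
      rw [tensMap_boundary G.coRepLD G.coRepLL _ _ (fun _ _ => rfl), hx, map_zero]
      intro a v
      exact (derL_proj _ v).symm)

variable (k m g) in
/-- `F^r_s = g ⊗ D_n(g)^{⊗ s} ⊗ ker (D_n(g)^{⊗ (r+1)} → L_n(g)^{⊗ (r+1)})`, as a subspace of
`g ⊗ D_n(g)^{⊗ (s+r+1)}`. -/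
def block (r s : ℕ) : Submodule k (tens k g (DPow k m g) (s + r + 1)) :=
  Submodule.map₂ (concat k g (DPow k m g) s r) ⊤
    (LinearMap.ker (tensMap (proj k m g) (proj k m g) r))

variable (k m g) in
theorem block_le_ker (r s : ℕ) : block k m g r s ≤
    LinearMap.ker (tensMap (LinearMap.id (R := k) (M := g)) (proj k m g) (s + r + 1)) := by
  rw [block, Submodule.map₂_le]
  intro x _ w hw
  rw [LinearMap.mem_ker] at hw ⊢
  rw [tensMap_concat, hw, map_zero]

/-- The filtration of the relative complex: the `p`-th step in degree `i` is `F^p_{i-p}` for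
`0 ≤ p ≤ i`, is `F^i_0` for `p ≥ i`, and is zero for `p < 0`. -/
def filtration : ℤ → ∀ i : ℕ, Submodule k (G.complexRel.X i)
  | Int.ofNat p, i =>
      (Nat.sub_add_min_cancel i p ▸ block k m g (min i p) (i - p) :
        Submodule k (tens k g (DPow k m g) (i + 1))).comap (Submodule.subtype _)
  | Int.negSucc _, _ => ⊥

end FilippovAlgebra

end NAry

/-! ### Filtered complexes and their spectral sequences -/

section Filtered

variable (C : ChainComplex (ModuleCat.{u} k) ℕ) (F : ℤ → ∀ i : ℕ, Submodule k (C.X i))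

/-- `F` is an increasing filtration of the complex `C` by subcomplexes, with `F_{-1} = 0` and with
`F_i` everything in degree `i`. -/
structure IsBoundedFiltration : Prop where
  mono : ∀ (p q : ℤ) (i : ℕ), p ≤ q → F p i ≤ F q i
  d_mem : ∀ (p : ℤ) (i j : ℕ), ∀ x ∈ F p i, (C.d i j).hom x ∈ F p j
  eq_bot : ∀ (p : ℤ) (i : ℕ), p < 0 → F p i = ⊥
  eq_top : ∀ (p : ℤ) (i : ℕ), (i : ℤ) ≤ p → F p i = ⊤

/-- `Z^r_p = {x ∈ F_p C_i | d x ∈ F_{p-r} C_{i-1}}`. -/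
def approxCycles (r p : ℤ) (i : ℕ) : Submodule k (C.X i) :=
  F p i ⊓ ⨅ j : ℕ, (F (p - r) j).comap (C.d i j).hom

/-- The filtration of `H_i(C)`: the classes that are represented by cycles in `F_p`. -/
def homologyFiltration (p : ℤ) (i : ℕ) : Submodule k (C.homology i) :=
  ((F p i).comap (C.iCycles i).hom).map (C.homologyπ i).hom

/-- First quadrant homological spectral sequences of `k`-modules, starting with the page `E^0`;
the differential of `E^r` has bidegree `(-r, r - 1)`. -/
abbrev HomologicalSpectralSequence (k : Type u) [CommRing k] :=
  SpectralSequence (ModuleCat.{u} k)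
    (fun r : ℤ => ComplexShape.spectralSequenceNat (⟨-r, r - 1⟩ : ℤ × ℤ)) 0

/-- The data exhibiting `E` as the spectral sequence of the filtered complex `(C, F)`:
identifications `E^r_{p,q} = Z^r_p / (Z^r_p ∩ (F_{p-1} + d F_{p+r-1}))` in total degree `p + q`,
such that `d^r` is induced by `d` and the isomorphism `H(E^r) ≅ E^{r+1}` by the identity
on representatives. -/
structure SpectralSequenceOfFiltration (E : HomologicalSpectralSequence.{u} k) where
  /-- the class in `E^r_{p,q}` of an element of `Z^r_p` -/
  cls (r p q : ℕ) : approxCycles C F r p (p + q) →ₗ[k] (E.page (r : ℤ)).X (p, q)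
  surjective : ∀ r p q, Function.Surjective (cls r p q)
  cls_eq_zero_iff : ∀ (r p q : ℕ) (x : approxCycles C F r p (p + q)),
    cls r p q x = 0 ↔ ∃ w ∈ F ((p : ℤ) - 1) (p + q), ∃ y ∈ F ((p : ℤ) + r - 1) (p + q + 1),
      (x : C.X (p + q)) = (C.d (p + q + 1) (p + q)).hom y + w
  d_cls : ∀ (r p q p' q' : ℕ), (p' : ℤ) + r = p → (q' : ℤ) + 1 = q + r →
    ∀ (x : approxCycles C F r p (p + q)) (y : approxCycles C F r p' (p' + q')),
      (y : C.X (p' + q')) = (C.d (p + q) (p' + q')).hom (x : C.X (p + q)) →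
      ((E.page (r : ℤ)).d (p, q) (p', q')).hom (cls r p q x) = cls r p' q' y
  iso_cls : ∀ (r p q : ℕ) (z : (E.page (r : ℤ)).cycles (p, q))
    (x : approxCycles C F r p (p + q)) (x' : approxCycles C F ((r + 1 : ℕ) : ℤ) p (p + q)),
      (x : C.X (p + q)) = x' → ((E.page (r : ℤ)).iCycles (p, q)).hom z = cls r p q x →
      (E.iso (r : ℤ) ((r + 1 : ℕ) : ℤ) (p, q)).hom.hom
        (((E.page (r : ℤ)).homologyπ (p, q)).hom z) = cls (r + 1) p q x'

/-- `E` converges to the graded module `A`, filtered by `Φ`: each filtration `Φ_p A_i` is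
increasing, with `Φ_{-1} A_i = 0` and `Φ_i A_i = A_i`, and at each place `(p, q)` the
differentials from and to `E^r_{p,q}` vanish for all large `r` and the resulting stable value
`E^∞_{p,q}` is isomorphic to `Φ_p A_{p+q} / Φ_{p-1} A_{p+q}`. -/
structure ConvergesTo (E : HomologicalSpectralSequence.{u} k) (A : ℕ → ModuleCat.{u} k)
    (Φ : ℤ → ∀ i : ℕ, Submodule k (A i)) : Prop where
  mono : ∀ (p q : ℤ) (i : ℕ), p ≤ q → Φ p i ≤ Φ q i
  eq_bot : ∀ (p : ℤ) (i : ℕ), p < 0 → Φ p i = ⊥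
  eq_top : ∀ (p : ℤ) (i : ℕ), (i : ℤ) ≤ p → Φ p i = ⊤
  stable : ∀ p q : ℕ, ∃ r₁ : ℕ, ∀ r : ℕ, r₁ ≤ r →
    (∀ a, (E.page (r : ℤ)).d (p, q) a = 0) ∧ (∀ a, (E.page (r : ℤ)).d a (p, q) = 0) ∧
    Nonempty ((E.page (r : ℤ)).X (p, q) ≃ₗ[k]
      (Φ (p : ℤ) (p + q) ⧸ (Φ ((p : ℤ) - 1) (p + q)).comap (Φ (p : ℤ) (p + q)).subtype))

end Filtered

end LeibnizHomology

end

open LeibnizHomology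

/-!
The argument has three layers.

*The spectral sequence of a filtered complex.* Mathlib has the notion of a spectral sequence but
not this construction for a filtered complex of modules, so it is made directly: `page` has the
terms `E^r_{p,q} = Z^r_p / (Z^r_p ∩ (F_{p-1} + d F_{p+r-1}))`. Everything rests on the two facts
that a class in `E^r` killed by `d^r` is represented in `Z^{r+1}` (`exists_approxCycles_succ`), and
that an element of `Z^{r+1}` vanishes in `E^{r+1}` exactly when its class in `E^r` is a boundary
(`mem_approxBoundaries_succ_iff`). As `F_{-1} = 0` and `F_i` is everything in degree `i`, no
differential leaves or enters a given place for large `r`, which gives convergence.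

*A criterion for the second page.* Suppose that `F_p / F_{p-1}` is identified in degree `p + q` with
`A_q ⊗ V_p` for complexes `A` and `V`, that `d` induces `d ⊗ 1` on it, and that on
`E¹ = H_q(A) ⊗ V_p` the differential is `± 1 ⊗ d` (`TensorGrading`). Over a field, tensor products
preserve homology, hence `E² = H_q(A) ⊗ H_p(V)`. To stay with elements, the homology class map of
each complex is extended to a linear map `ρ` on all chains (`exists_isHomologyClass`); the
isomorphism is then induced by `ρ ⊗ σ` on `Z²_p` (`TensorGrading.nonempty_page_two_equiv`).

*The relative complex.* Let `x ∈ g ⊗ D^{⊗ s}` and `w ∈ D^{⊗ (r+1)}`. The boundary of `x ⊗ w`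
consists of `d x ⊗ w`, of `± x ⊗ d w`, and of the terms in which a factor of `w` acts on `x`
(`boundary_cat_succ`). Because the bracket is alternating, the action of `D` factors through `L`;
so if `w` lies in `ker (D^{⊗ (r+1)} → L^{⊗ (r+1)})`, then the last two kinds of terms lie in the
next smaller step of the filtration (`FilippovAlgebra.lTensor_boundary`). Thus the filtration
consists of subcomplexes, and the differential of `E⁰` is `d ⊗ 1`. The graded pieces are
`(g ⊗ D^{⊗ q}) ⊗ ker (D ⊗ L^{⊗ p} → L^{⊗ (p+1)})`, because
`ker (D^{⊗ (p+1)} → D ⊗ L^{⊗ p}) = D ⊗ ker (D^{⊗ p} → L^{⊗ p})` (`mem_step_succ_iff`). On `E¹` the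
terms in which `w` acts on a cycle `x` disappear, since Leibniz algebras act trivially on their
homology: `[b, x]` is up to sign the boundary of `x ⊗ b` (`FilippovAlgebra.map_leftAct_eq_zero`).
What remains is `± 1 ⊗ d`.
-/

noncomputable section

namespace LeibnizHomology

/-! ### Homology of complexes of modules in terms of elements -/

section Homology

variable {k : Type u} [CommRing k] {ι : Type} {c : ComplexShape ι}
  (K : HomologicalComplex (ModuleCat.{u} k) c)

theorem iCycles_injective (i : ι) : Function.Injective (K.iCycles i).hom :=
  (ModuleCat.mono_iff_injective _).1 inferInstance

theorem homologyπ_surjective (i : ι) : Function.Surjective (K.homologyπ i).hom :=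
  (ModuleCat.epi_iff_surjective _).1 inferInstance

theorem d_iCycles_apply (i j : ι) (z : K.cycles i) :
    (K.d i j).hom ((K.iCycles i).hom z) = 0 := by
  exact congrArg (fun f => f.hom z) (K.iCycles_d i j)

theorem d_d_apply (i j l : ι) (x : K.X i) : (K.d j l).hom ((K.d i j).hom x) = 0 := by
  exact congrArg (fun f => f.hom x) (K.d_comp_d i j l)

theorem exists_iCycles_eq (i : ι) (x : K.X i) (hx : ∀ j, (K.d i j).hom x = 0) :
    ∃ z, (K.iCycles i).hom z = x := by
  have h := ShortComplex.exact_of_f_is_kernel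
    (ShortComplex.mk _ _ (K.iCycles_d i (c.next i))) (K.cyclesIsKernel i _ rfl)
  exact (ShortComplex.moduleCat_exact_iff _).1 h x (hx _)

theorem homologyπ_eq_zero_iff (i : ι) (z : K.cycles i) :
    (K.homologyπ i).hom z = 0 ↔ ∃ j, ∃ y : K.X j, (K.d j i).hom y = (K.iCycles i).hom z := by
  constructor
  · intro hz
    have h := ShortComplex.exact_of_g_is_cokernel
      (ShortComplex.mk _ _ (K.toCycles_comp_homologyπ (c.prev i) i)) (K.homologyIsCokernel _ i rfl)
    obtain ⟨y, hy⟩ := (ShortComplex.moduleCat_exact_iff _).1 h z hz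
    refine ⟨_, y, ?_⟩
    rw [← K.toCycles_i (c.prev i) i]
    exact congrArg (K.iCycles i).hom hy
  · rintro ⟨j, y, hy⟩
    have hz : z = (K.toCycles j i).hom y := by
      apply iCycles_injective K i
      rw [← hy, ← K.toCycles_i j i]
      rfl
    rw [hz]
    exact congrArg (fun f => f.hom y) (K.toCycles_comp_homologyπ j i)

theorem exists_linearMap_cycles {M : Type u} [AddCommGroup M] [Module k M] (i : ι)
    (φ : M →ₗ[k] K.X i) (hφ : ∀ j x, (K.d i j).hom (φ x) = 0) :
    ∃ l : M →ₗ[k] K.cycles i, ∀ x, (K.iCycles i).hom (l x) = φ x := by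
  have h : ModuleCat.ofHom φ ≫ K.d i (c.next i) = 0 :=
    ModuleCat.hom_ext (LinearMap.ext fun x => hφ _ x)
  exact ⟨(K.liftCycles (ModuleCat.ofHom φ) _ rfl h).hom,
    fun x => congrArg (fun f => f.hom x) (K.liftCycles_i (ModuleCat.ofHom φ) _ rfl h)⟩

end Homology

theorem exists_linearEquiv_of_surjective {k M N P : Type*} [Ring k] [AddCommGroup M] [Module k M]
    [AddCommGroup N] [Module k N] [AddCommGroup P] [Module k P] (f : M →ₗ[k] N) (f' : M →ₗ[k] P)
    (hf : Function.Surjective f) (hf' : Function.Surjective f')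
    (h : ∀ x, f x = 0 ↔ f' x = 0) : ∃ e : N ≃ₗ[k] P, ∀ x, e (f x) = f' x := by
  have hk : LinearMap.ker f = LinearMap.ker f' := by ext x; exact h x
  refine ⟨(f.quotKerEquivOfSurjective hf).symm ≪≫ₗ Submodule.quotEquivOfEq _ _ hk ≪≫ₗ
    f'.quotKerEquivOfSurjective hf', fun x => ?_⟩
  have hx : (f.quotKerEquivOfSurjective hf).symm (f x) = Submodule.Quotient.mk x := by
    rw [LinearEquiv.symm_apply_eq]
    rfl
  rw [LinearEquiv.trans_apply, LinearEquiv.trans_apply, hx]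
  rfl

/-! ### The spectral sequence of a filtered complex -/

section Pages

variable {k : Type u} [CommRing k] (C : ChainComplex (ModuleCat.{u} k) ℕ)
  (F : ℤ → ∀ i : ℕ, Submodule k (C.X i))

/-- `F_{p-1} C_i + d F_{p+r-1} C_{i+1}`; the supremum over all `j` only sees `j = i + 1`. -/
def approxBoundaries (r p : ℤ) (i : ℕ) : Submodule k (C.X i) :=
  F (p - 1) i ⊔ ⨆ j : ℕ, (F (p + r - 1) j).map (C.d j i).hom

variable {C F}

theorem mem_approxCycles {r p : ℤ} {i : ℕ} {x : C.X i} :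
    x ∈ approxCycles C F r p i ↔ x ∈ F p i ∧ ∀ j, (C.d i j).hom x ∈ F (p - r) j := by
  simp [approxCycles]

theorem mem_approxBoundaries {r p : ℤ} {i : ℕ} {x : C.X i} :
    x ∈ approxBoundaries C F r p i ↔
      ∃ w ∈ F (p - 1) i, ∃ y ∈ F (p + r - 1) (i + 1), x = (C.d (i + 1) i).hom y + w := by
  have h : (⨆ j : ℕ, (F (p + r - 1) j).map (C.d j i).hom) =
      (F (p + r - 1) (i + 1)).map (C.d (i + 1) i).hom := by
    refine le_antisymm (iSup_le fun j => ?_) (le_iSup (fun j => (F (p + r - 1) j).map (C.d j i).hom)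
      (i + 1))
    by_cases hj : j = i + 1
    · rw [hj]
    · rw [C.shape j i (fun h => hj h.symm)]
      rintro _ ⟨y, _, rfl⟩
      exact zero_mem _
  rw [approxBoundaries, h, Submodule.mem_sup]
  constructor
  · rintro ⟨w, hw, _, ⟨y, hy, rfl⟩, rfl⟩
    exact ⟨w, hw, y, hy, add_comm _ _⟩
  · rintro ⟨w, hw, y, hy, rfl⟩
    exact ⟨w, hw, _, ⟨y, hy, rfl⟩, add_comm _ _⟩

theorem d_mem_approxBoundaries {r p : ℤ} {i j : ℕ} {y : C.X j} (hy : y ∈ F (p + r - 1) j) :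
    (C.d j i).hom y ∈ approxBoundaries C F r p i :=
  Submodule.mem_sup_right (Submodule.mem_iSup_of_mem j (Submodule.mem_map_of_mem hy))

variable (C F)

/-- `Z^r_p / (Z^r_p ∩ (F_{p-1} + d F_{p+r-1}))` in total degree `a.1 + a.2`, with `p = a.1`. -/
abbrev PageModule (r : ℤ) (a : ℕ × ℕ) : Type u :=
  approxCycles C F r a.1 (a.1 + a.2) ⧸
    (approxBoundaries C F r a.1 (a.1 + a.2)).comap (approxCycles C F r a.1 (a.1 + a.2)).subtype

/-- The class in `E^r_{p,q}` of an element of `Z^r_p`. -/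
def pageMk (r : ℤ) (a : ℕ × ℕ) : approxCycles C F r a.1 (a.1 + a.2) →ₗ[k] PageModule C F r a :=
  Submodule.mkQ _

theorem pageMk_surjective (r : ℤ) (a : ℕ × ℕ) : Function.Surjective (pageMk C F r a) :=
  Submodule.mkQ_surjective _

variable {C F} in
theorem pageMk_eq_zero_iff {r : ℤ} {a : ℕ × ℕ} {x : approxCycles C F r a.1 (a.1 + a.2)} :
    pageMk C F r a x = 0 ↔ (x : C.X (a.1 + a.2)) ∈ approxBoundaries C F r a.1 (a.1 + a.2) :=
  Submodule.Quotient.mk_eq_zero _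

variable {C F} in
theorem d_mem_approxCycles {r p p' : ℤ} {i j : ℕ} (h : p' = p - r) {x : C.X i}
    (hx : x ∈ approxCycles C F r p i) : (C.d i j).hom x ∈ approxCycles C F r p' j := by
  rw [mem_approxCycles] at hx ⊢
  refine ⟨h ▸ hx.2 j, fun l => ?_⟩
  rw [d_d_apply]
  exact zero_mem _

variable {C F} in
theorem d_mem_approxBoundaries_of_mem {r p p' : ℤ} {i j : ℕ} (h : p' = p - r) {x : C.X i}
    (hx : x ∈ approxBoundaries C F r p i) : (C.d i j).hom x ∈ approxBoundaries C F r p' j := by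
  obtain ⟨w, hw, y, _, rfl⟩ := mem_approxBoundaries.1 hx
  rw [map_add, d_d_apply, zero_add]
  refine d_mem_approxBoundaries ?_
  rwa [show p' + r - 1 = p - 1 by rw [h]; ring]

/-- The differential of `E^r` between two places in the position `(-r, r - 1)`. -/
def pageDOfRel (r : ℤ) (a b : ℕ × ℕ) (h : (b.1 : ℤ) = a.1 - r) :
    PageModule C F r a →ₗ[k] PageModule C F r b :=
  Submodule.mapQ _ _ ((C.d (a.1 + a.2) (b.1 + b.2)).hom.restrict
      fun _ hx => d_mem_approxCycles h hx)
    (fun _ hx => d_mem_approxBoundaries_of_mem h hx)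

open Classical in
/-- The differential of `E^r`, induced by the one of `C` and zero between places that are not in
the position `(-r, r - 1)`. -/
def pageD (r : ℤ) (a b : ℕ × ℕ) : PageModule C F r a →ₗ[k] PageModule C F r b :=
  if h : (ComplexShape.spectralSequenceNat (⟨-r, r - 1⟩ : ℤ × ℤ)).Rel a b then
    pageDOfRel C F r a b (by have := h.1; dsimp at this; lia)
  else 0

theorem pageD_pageMk (r : ℤ) (a b : ℕ × ℕ)
    (h : (ComplexShape.spectralSequenceNat (⟨-r, r - 1⟩ : ℤ × ℤ)).Rel a b)
    (x : approxCycles C F r a.1 (a.1 + a.2)) (y : approxCycles C F r b.1 (b.1 + b.2))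
    (hy : (y : C.X (b.1 + b.2)) = (C.d (a.1 + a.2) (b.1 + b.2)).hom (x : C.X (a.1 + a.2))) :
    pageD C F r a b (pageMk C F r a x) = pageMk C F r b y := by
  rw [pageD, dif_pos h]
  exact congrArg (pageMk C F r b) (Subtype.ext hy.symm)

theorem exists_pageD_pageMk (r : ℤ) (a b : ℕ × ℕ)
    (h : (ComplexShape.spectralSequenceNat (⟨-r, r - 1⟩ : ℤ × ℤ)).Rel a b)
    (x : approxCycles C F r a.1 (a.1 + a.2)) :
    ∃ y : approxCycles C F r b.1 (b.1 + b.2),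
      (y : C.X (b.1 + b.2)) = (C.d (a.1 + a.2) (b.1 + b.2)).hom (x : C.X (a.1 + a.2)) ∧
      pageD C F r a b (pageMk C F r a x) = pageMk C F r b y := by
  have h' : (b.1 : ℤ) = a.1 - r := by have := h.1; dsimp at this; lia
  exact ⟨⟨_, d_mem_approxCycles h' x.2⟩, rfl, pageD_pageMk C F r a b h x _ rfl⟩

/-- The page `E^r`. -/
def page (r : ℤ) :
    HomologicalComplex (ModuleCat.{u} k)
      (ComplexShape.spectralSequenceNat (⟨-r, r - 1⟩ : ℤ × ℤ)) where
  X a := ModuleCat.of k (PageModule C F r a)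
  d a b := ModuleCat.ofHom (pageD C F r a b)
  shape a b h := by
    rw [pageD, dif_neg h]
    rfl
  d_comp_d' a b c hab hbc := by
    refine ModuleCat.hom_ext (LinearMap.ext fun x => ?_)
    obtain ⟨x, rfl⟩ := pageMk_surjective C F r a x
    obtain ⟨y, hy, h1⟩ := exists_pageD_pageMk C F r a b hab x
    change pageD C F r b c (pageD C F r a b (pageMk C F r a x)) = 0
    rw [h1, pageD_pageMk C F r b c hbc y 0, map_zero]
    rw [hy, d_d_apply]
    rfl

variable {C F}

theorem approxCycles_succ_le (hF : IsBoundedFiltration C F) (r p : ℤ) (i : ℕ) :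
    approxCycles C F (r + 1) p i ≤ approxCycles C F r p i := by
  intro x hx
  rw [mem_approxCycles] at hx ⊢
  exact ⟨hx.1, fun j => hF.mono _ _ _ (by lia) (hx.2 j)⟩

theorem approxBoundaries_le_succ (hF : IsBoundedFiltration C F) (r p : ℤ) (i : ℕ) :
    approxBoundaries C F r p i ≤ approxBoundaries C F (r + 1) p i := by
  intro x hx
  rw [mem_approxBoundaries] at hx ⊢
  obtain ⟨w, hw, y, hy, rfl⟩ := hx
  exact ⟨w, hw, y, hF.mono _ _ _ (by lia) hy, rfl⟩

/-- A class of `E^r` which is a cycle for `d^r` is represented by an element of `Z^{r+1}`. -/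
theorem exists_approxCycles_succ (hF : IsBoundedFiltration C F) {r : ℤ} (a : ℕ × ℕ)
    (z : PageModule C F r a) (hz : ∀ b, pageD C F r a b z = 0) :
    ∃ x : approxCycles C F (r + 1) a.1 (a.1 + a.2),
      pageMk C F r a ⟨x, approxCycles_succ_le hF _ _ _ x.2⟩ = z := by
  obtain ⟨⟨x, hx⟩, rfl⟩ := pageMk_surjective C F r a z
  have hx' := mem_approxCycles.1 hx
  by_cases hb : ∃ b, (ComplexShape.spectralSequenceNat (⟨-r, r - 1⟩ : ℤ × ℤ)).Rel a b
  · obtain ⟨b, hab⟩ := hb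
    obtain ⟨b₁, b₂⟩ := b
    have h1 : (a.1 : ℤ) + -r = b₁ := hab.1
    have h2 : (a.2 : ℤ) + (r - 1) = b₂ := hab.2
    obtain ⟨⟨y, hy⟩, hyx, hy'⟩ := exists_pageD_pageMk C F r a _ hab ⟨x, hx⟩
    rw [hz _, eq_comm, pageMk_eq_zero_iff, mem_approxBoundaries] at hy'
    obtain ⟨w, hw, v, hv, hvw⟩ := hy'
    have hi : a.1 + a.2 = b₁ + b₂ + 1 := by lia
    dsimp only at hyx hw hv hvw
    generalize hv' : b₁ + b₂ + 1 = i at v hi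
    subst hi
    rw [show (b₁ : ℤ) + r - 1 = a.1 - 1 by lia] at hv
    rw [show (b₁ : ℤ) - 1 = a.1 - (r + 1) by lia] at hw
    have hdx : (C.d (a.1 + a.2) (b₁ + b₂)).hom (x - v) = w := by
      rw [map_sub, ← hyx, hvw, add_sub_cancel_left]
    have hxv : x - v ∈ approxCycles C F (r + 1) a.1 (a.1 + a.2) := by
      refine mem_approxCycles.2 ⟨sub_mem hx'.1 (hF.mono _ _ _ (by lia) hv), fun j => ?_⟩
      by_cases hj : j = b₁ + b₂
      · subst hj; rwa [hdx]
      · rw [C.shape _ _ (fun h => hj (by have : j + 1 = _ := h; lia))]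
        exact zero_mem _
    refine ⟨⟨_, hxv⟩, ?_⟩
    rw [← sub_eq_zero, ← map_sub, pageMk_eq_zero_iff, mem_approxBoundaries]
    refine ⟨-v, neg_mem hv, 0, zero_mem _, ?_⟩
    simp
  · refine ⟨⟨x, mem_approxCycles.2 ⟨hx'.1, fun j => ?_⟩⟩, rfl⟩
    by_cases hj : j + 1 = a.1 + a.2
    · by_cases hr' : (a.1 : ℤ) < r
      · have := hx'.2 j
        rw [hF.eq_bot _ _ (by lia)] at this
        rw [(Submodule.mem_bot _).1 this]
        exact zero_mem _
      · -- only `r = 0` and `a.2 = 0` are left, where `F_{p-1}` is everything in degree `p - 1`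
        have h0 : (a.2 : ℤ) + (r - 1) < 0 := by
          by_contra h0
          refine hb ⟨⟨(a.1 + -r).toNat, (a.2 + (r - 1)).toNat⟩, ?_, ?_⟩
          · dsimp; lia
          · dsimp; lia
        rw [hF.eq_top _ _ (by lia)]
        trivial
    · rw [C.shape _ _ hj]
      exact zero_mem _

/-- An element of `Z^{r+1}` is zero in `E^{r+1}` if and only if its class in `E^r` is a
boundary for `d^r`. -/
theorem mem_approxBoundaries_succ_iff (hF : IsBoundedFiltration C F) {r : ℤ} (hr : 0 ≤ r)
    (a : ℕ × ℕ) (x : approxCycles C F (r + 1) a.1 (a.1 + a.2)) :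
    (x : C.X (a.1 + a.2)) ∈ approxBoundaries C F (r + 1) a.1 (a.1 + a.2) ↔
      ∃ b, ∃ y, pageD C F r b a y =
        pageMk C F r a ⟨x, approxCycles_succ_le hF _ _ _ x.2⟩ := by
  obtain ⟨x, hx⟩ := x
  obtain ⟨a₁, a₂⟩ := a
  dsimp only at *
  constructor
  · intro h
    obtain ⟨w, hw, y, hy, hxy⟩ := mem_approxBoundaries.1 h
    by_cases hq : r ≤ a₂ + 1
    · let b : ℕ × ℕ := ⟨(a₁ + r).toNat, (a₂ + 1 - r).toNat⟩
      have hb : (ComplexShape.spectralSequenceNat (⟨-r, r - 1⟩ : ℤ × ℤ)).Rel b (a₁, a₂) := by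
        constructor
        · dsimp [b]; lia
        · dsimp [b]; lia
      have hi : b.1 + b.2 = a₁ + a₂ + 1 := by dsimp [b]; lia
      have hb1 : (b.1 : ℤ) = a₁ + (r + 1) - 1 := by dsimp [b]; lia
      generalize hv' : a₁ + a₂ + 1 = i at y hi
      subst hi
      have hyZ : y ∈ approxCycles C F r b.1 (b.1 + b.2) := by
        refine mem_approxCycles.2 ⟨hb1 ▸ hy, fun j => ?_⟩
        by_cases hj : j = a₁ + a₂
        · subst hj
          rw [show (C.d (b.1 + b.2) (a₁ + a₂)).hom y = x - w by rw [hxy, add_sub_cancel_right],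
            show (b.1 : ℤ) - r = a₁ by lia]
          exact sub_mem (mem_approxCycles.1 hx).1 (hF.mono _ _ _ (by lia) hw)
        · rw [C.shape _ _ (fun h => hj (by have : j + 1 = _ := h; lia))]
          exact zero_mem _
      refine ⟨b, pageMk C F r b ⟨y, hyZ⟩, ?_⟩
      obtain ⟨v, hv, h⟩ := exists_pageD_pageMk C F r b (a₁, a₂) hb ⟨y, hyZ⟩
      rw [h, eq_comm, ← sub_eq_zero, ← map_sub, pageMk_eq_zero_iff, mem_approxBoundaries]
      refine ⟨w, hw, 0, zero_mem _, ?_⟩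
      change x - (v : C.X (a₁ + a₂)) = _
      rw [hv, hxy, map_zero, zero_add, add_sub_cancel_left]
    · -- here no differential reaches the place, and `F_{p+r-1}` is everything in degree `p+q+1`
      refine ⟨(a₁, a₂), 0, ?_⟩
      rw [map_zero, eq_comm, pageMk_eq_zero_iff, mem_approxBoundaries]
      refine ⟨w, hw, y, ?_, hxy⟩
      rw [hF.eq_top _ _ (by dsimp; lia)]
      trivial
  · rintro ⟨b, y, h⟩
    by_cases hb : (ComplexShape.spectralSequenceNat (⟨-r, r - 1⟩ : ℤ × ℤ)).Rel b (a₁, a₂)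
    · obtain ⟨⟨y, hy⟩, rfl⟩ := pageMk_surjective C F r b y
      obtain ⟨⟨v, hvZ⟩, hv, h'⟩ := exists_pageD_pageMk C F r b (a₁, a₂) hb ⟨y, hy⟩
      rw [h', eq_comm, ← sub_eq_zero, ← map_sub, pageMk_eq_zero_iff] at h
      have h2 := approxBoundaries_le_succ hF _ _ _ h
      have h3 : (C.d (b.1 + b.2) (a₁ + a₂)).hom y ∈ approxBoundaries C F (r + 1) a₁ (a₁ + a₂) := by
        refine d_mem_approxBoundaries ?_
        have : (b.1 : ℤ) = a₁ + (r + 1) - 1 := by have := hb.1; dsimp at this; lia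
        exact this ▸ (mem_approxCycles.1 hy).1
      have h4 := add_mem h2 h3
      change x - v + _ ∈ _ at h4
      dsimp only at hv
      rwa [← hv, sub_add_cancel] at h4
    · rw [pageD, dif_neg hb, LinearMap.zero_apply, eq_comm, pageMk_eq_zero_iff] at h
      exact approxBoundaries_le_succ hF _ _ _ h

/-- `H(E^r) ≅ E^{r+1}`, induced by the identity on representatives: both modules are quotients of
`Z^{r+1}` by the same submodule. -/
theorem exists_homology_page_equiv (hF : IsBoundedFiltration C F) {r r' : ℤ} (hr : 0 ≤ r)
    (hr' : r + 1 = r') (a : ℕ × ℕ) :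
    ∃ e : (page C F r).homology a ≃ₗ[k] (page C F r').X a,
      ∀ (z : (page C F r).cycles a) (x : approxCycles C F r a.1 (a.1 + a.2))
        (x' : approxCycles C F r' a.1 (a.1 + a.2)), (x : C.X (a.1 + a.2)) = x' →
        ((page C F r).iCycles a).hom z = pageMk C F r a x →
        e (((page C F r).homologyπ a).hom z) = pageMk C F r' a x' := by
  subst hr'
  let inc : approxCycles C F (r + 1) a.1 (a.1 + a.2) →ₗ[k] (page C F r).X a :=
    pageMk C F r a ∘ₗ Submodule.inclusion (approxCycles_succ_le hF _ _ _)
  have hinc : ∀ x, inc x = pageMk C F r a ⟨x, approxCycles_succ_le hF _ _ _ x.2⟩ := fun _ => rfl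
  have hd : ∀ x b, ((page C F r).d a b).hom (inc x) = 0 := by
    intro x b
    suffices h : pageD C F r a b (pageMk C F r a ⟨x, approxCycles_succ_le hF _ _ _ x.2⟩) = 0 from h
    by_cases hb : (ComplexShape.spectralSequenceNat (⟨-r, r - 1⟩ : ℤ × ℤ)).Rel a b
    · obtain ⟨y, hy, h⟩ := exists_pageD_pageMk C F r a b hb
        ⟨x, approxCycles_succ_le hF _ _ _ x.2⟩
      rw [h, pageMk_eq_zero_iff, mem_approxBoundaries]
      refine ⟨_, ?_, 0, zero_mem _, by rw [map_zero, zero_add]⟩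
      have h1 := (mem_approxCycles.1 x.2).2 (b.1 + b.2)
      have : (a.1 : ℤ) - (r + 1) = b.1 - 1 := by have := hb.1; dsimp at this; lia
      rw [hy]
      exact this ▸ h1
    · rw [pageD, dif_neg hb, LinearMap.zero_apply]
  obtain ⟨lift, hlift⟩ := exists_linearMap_cycles (page C F r) a inc (fun b x => hd x b)
  obtain ⟨e, he⟩ := exists_linearEquiv_of_surjective
    (((page C F r).homologyπ a).hom ∘ₗ lift) (pageMk C F (r + 1) a) (by
      intro h
      obtain ⟨z, rfl⟩ := homologyπ_surjective _ a h
      obtain ⟨x, hx⟩ := exists_approxCycles_succ hF a (((page C F r).iCycles a).hom z)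
        (fun b => d_iCycles_apply (page C F r) a b z)
      refine ⟨x, congrArg ((page C F r).homologyπ a).hom (iCycles_injective _ a ?_)⟩
      rw [hlift]
      exact hx) (pageMk_surjective C F (r + 1) a) (by
      intro x
      refine (homologyπ_eq_zero_iff _ a (lift x)).trans (Iff.trans ?_
        (pageMk_eq_zero_iff.trans (mem_approxBoundaries_succ_iff hF hr a x)).symm)
      rw [hlift]
      exact ⟨fun ⟨b, y, h⟩ => ⟨b, y, h⟩, fun ⟨b, y, h⟩ => ⟨b, y, h⟩⟩)
  refine ⟨e, fun z x x' hxx' hz => ?_⟩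
  rw [← he x']
  refine congrArg e (congrArg _ (iCycles_injective _ a ?_))
  rw [hlift, hz, hinc]
  exact congrArg (pageMk C F r a) (Subtype.ext hxx')

variable (C F) in
/-- The spectral sequence of a filtered complex. -/
def filteredSpectralSequence (hF : IsBoundedFiltration C F) : HomologicalSpectralSequence.{u} k where
  page r _ := page C F r
  iso _ _ a hrr' hr := (exists_homology_page_equiv hF hr hrr' a).choose.toModuleIso

variable (C F) in
/-- The tautological class maps from `Z^r_p` to the pages. -/
def filteredSpectralSequenceClass (hF : IsBoundedFiltration C F) :
    SpectralSequenceOfFiltration C F (filteredSpectralSequence C F hF) where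
  cls r p q := pageMk C F r (p, q)
  surjective r p q := pageMk_surjective C F r (p, q)
  cls_eq_zero_iff r p q x := by
    exact pageMk_eq_zero_iff.trans mem_approxBoundaries
  d_cls r p q p' q' hp hq x y hy := by
    exact pageD_pageMk C F r (p, q) (p', q') ⟨by dsimp; lia, by dsimp; lia⟩ x y hy
  iso_cls r p q z x x' hx hz :=
    (exists_homology_page_equiv hF (Int.natCast_nonneg r) (by push_cast; rfl)
      (p, q)).choose_spec z x x' hx hz

theorem homologyFiltration_mono (hF : IsBoundedFiltration C F) (p q : ℤ) (i : ℕ) (h : p ≤ q) :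
    homologyFiltration C F p i ≤ homologyFiltration C F q i :=
  Submodule.map_mono (Submodule.comap_mono (hF.mono p q i h))

theorem convergesTo_homologyFiltration (hF : IsBoundedFiltration C F) :
    ConvergesTo (filteredSpectralSequence C F hF) (fun i => C.homology i)
      (homologyFiltration C F) where
  mono := homologyFiltration_mono hF
  eq_bot p i hp := by
    rw [homologyFiltration, hF.eq_bot p i hp, eq_bot_iff]
    rintro _ ⟨z, hz, rfl⟩
    have : z = 0 := iCycles_injective C i (by rw [map_zero]; exact hz)
    rw [this, map_zero]
    exact zero_mem _
  eq_top p i hp := by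
    rw [homologyFiltration, hF.eq_top p i hp, Submodule.comap_top, Submodule.map_top,
      LinearMap.range_eq_top]
    exact homologyπ_surjective C i
  stable p q := by
    refine ⟨p + q + 2, fun r hr => ⟨fun a => ?_, fun a => ?_, ?_⟩⟩
    · refine (page C F r).shape _ _ fun h => ?_
      have := h.1
      dsimp at this
      lia
    · refine (page C F r).shape _ _ fun h => ?_
      have := h.2
      dsimp at this
      lia
    · -- Both modules are quotients of the cycles in `F_p` by those homologous to cycles in `F_{p-1}`.
      have hZ : ∀ x : approxCycles C F r p (p + q), ∀ j, (C.d (p + q) j).hom x.1 = 0 := by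
        intro x j
        have := (mem_approxCycles.1 x.2).2 j
        rwa [hF.eq_bot _ _ (by lia)] at this
      obtain ⟨lift, hlift⟩ := exists_linearMap_cycles C (p + q)
        (approxCycles C F r p (p + q)).subtype (fun j x => hZ x j)
      let ψ : approxCycles C F r p (p + q) →ₗ[k] homologyFiltration C F p (p + q) :=
        ((C.homologyπ (p + q)).hom ∘ₗ lift).codRestrict _ (fun x =>
          Submodule.mem_map_of_mem (by
            rw [Submodule.mem_comap, hlift]
            exact (mem_approxCycles.1 x.2).1))
      obtain ⟨e, _⟩ := exists_linearEquiv_of_surjective (pageMk C F r (p, q))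
        (Submodule.mkQ ((homologyFiltration C F ((p : ℤ) - 1) (p + q)).comap
          (homologyFiltration C F (p : ℤ) (p + q)).subtype) ∘ₗ ψ)
        (pageMk_surjective _ _ _ _) (by
          refine (Submodule.mkQ_surjective _).comp ?_
          rintro ⟨_, z, hz, rfl⟩
          refine ⟨⟨(C.iCycles (p + q)).hom z, mem_approxCycles.2 ⟨hz, fun j => ?_⟩⟩,
            Subtype.ext (congrArg (C.homologyπ (p + q)).hom (iCycles_injective C _ (hlift _)))⟩
          rw [d_iCycles_apply]
          exact zero_mem _) (by
          intro x
          rw [pageMk_eq_zero_iff, mem_approxBoundaries, LinearMap.comp_apply, Submodule.mkQ_apply,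
            Submodule.Quotient.mk_eq_zero]
          change _ ↔ (C.homologyπ (p + q)).hom (lift x) ∈ homologyFiltration C F (p - 1) (p + q)
          constructor
          · rintro ⟨w, hw, y, _, hxy⟩
            obtain ⟨z, hz⟩ := exists_iCycles_eq C (p + q) w (fun j => by
              have := hZ x j
              dsimp only at hxy
              rwa [hxy, map_add, d_d_apply, zero_add] at this)
            refine ⟨z, by rw [SetLike.mem_coe, Submodule.mem_comap, hz]; exact hw, ?_⟩
            rw [eq_comm, ← sub_eq_zero, ← map_sub, homologyπ_eq_zero_iff]
            refine ⟨_, y, ?_⟩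
            rw [map_sub, hlift, hz]
            exact (sub_eq_of_eq_add hxy).symm
          · rintro ⟨z, hz, hzx⟩
            rw [eq_comm, ← sub_eq_zero, ← map_sub, homologyπ_eq_zero_iff] at hzx
            obtain ⟨j, y, hy⟩ := hzx
            rw [map_sub, hlift] at hy
            by_cases hj : j = p + q + 1
            · subst hj
              refine ⟨_, hz, y, ?_, (sub_eq_iff_eq_add.1 hy.symm)⟩
              rw [hF.eq_top _ _ (by dsimp; lia)]
              trivial
            · rw [C.shape _ _ (fun h => hj h.symm)] at hy
              refine ⟨_, hz, 0, zero_mem _, ?_⟩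
              rw [map_zero]
              exact (sub_eq_iff_eq_add.1 hy.symm))
      exact ⟨e⟩

end Pages

/-! ### Homology classes and tensor products over a field -/

section HomologyClass

/-- `ρ` restricts to a surjection from the kernel of `d₀` onto `H`, whose kernel is the image
of `d₁`: it exhibits `H` as the homology of `X₁ → X₀ → X'` and is moreover extended to all
of `X₀`. -/
structure IsHomologyClass {k X₁ X₀ X' H : Type*} [CommRing k] [AddCommGroup X₁] [Module k X₁]
    [AddCommGroup X₀] [Module k X₀] [AddCommGroup X'] [Module k X'] [AddCommGroup H] [Module k H]
    (d₁ : X₁ →ₗ[k] X₀) (d₀ : X₀ →ₗ[k] X') (ρ : X₀ →ₗ[k] H) : Prop where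
  d_d : ∀ y, d₀ (d₁ y) = 0
  map_d : ∀ y, ρ (d₁ y) = 0
  exact : ∀ x, d₀ x = 0 → ρ x = 0 → ∃ y, d₁ y = x
  surjective : ∀ h, ∃ x, d₀ x = 0 ∧ ρ x = h

theorem mem_range_rTensor_ker_subtype {k X X' V : Type*} [Field k]
    [AddCommGroup X] [Module k X] [AddCommGroup X'] [Module k X']
    [AddCommGroup V] [Module k V] (d : X →ₗ[k] X') (t : X ⊗[k] V)
    (ht : d.rTensor V t = 0) : ∃ t', (LinearMap.ker d).subtype.rTensor V t' = t :=
  (Module.Flat.rTensor_exact V (LinearMap.exact_subtype_ker_map d) t).1 ht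

namespace IsHomologyClass

variable {k X₁ X₀ X' H : Type*} [Field k] [AddCommGroup X₁] [Module k X₁]
    [AddCommGroup X₀] [Module k X₀] [AddCommGroup X'] [Module k X'] [AddCommGroup H] [Module k H]
    {d₁ : X₁ →ₗ[k] X₀} {d₀ : X₀ →ₗ[k] X'} {ρ : X₀ →ₗ[k] H}
    (V : Type*) [AddCommGroup V] [Module k V]

theorem rTensor (h : IsHomologyClass d₁ d₀ ρ) :
    IsHomologyClass (d₁.rTensor V) (d₀.rTensor V) (ρ.rTensor V) where
  d_d y := by
    rw [← LinearMap.comp_apply, ← LinearMap.rTensor_comp, show d₀ ∘ₗ d₁ = 0 from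
      LinearMap.ext h.d_d, LinearMap.rTensor_zero, LinearMap.zero_apply]
  map_d y := by
    rw [← LinearMap.comp_apply, ← LinearMap.rTensor_comp, show ρ ∘ₗ d₁ = 0 from
      LinearMap.ext h.map_d, LinearMap.rTensor_zero, LinearMap.zero_apply]
  exact t ht hρ := by
    obtain ⟨t', rfl⟩ := mem_range_rTensor_ker_subtype d₀ t ht
    have hex : Function.Exact (d₁.codRestrict (LinearMap.ker d₀) h.d_d)
        (ρ ∘ₗ (LinearMap.ker d₀).subtype) := by
      intro x
      constructor
      · intro hx
        obtain ⟨y, hy⟩ := h.exact x x.2 hx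
        exact ⟨y, Subtype.ext hy⟩
      · rintro ⟨y, rfl⟩
        exact h.map_d y
    have hsurj : Function.Surjective (ρ ∘ₗ (LinearMap.ker d₀).subtype) := by
      intro y
      obtain ⟨x, hx, rfl⟩ := h.surjective y
      exact ⟨⟨x, hx⟩, rfl⟩
    rw [← LinearMap.comp_apply, ← LinearMap.rTensor_comp] at hρ
    obtain ⟨s, rfl⟩ := (rTensor_exact V hex hsurj t').1 hρ
    refine ⟨s, ?_⟩
    rw [← LinearMap.comp_apply, ← LinearMap.rTensor_comp]
    rfl
  surjective v := by
    have hsurj : Function.Surjective (ρ ∘ₗ (LinearMap.ker d₀).subtype) := by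
      intro y
      obtain ⟨x, hx, rfl⟩ := h.surjective y
      exact ⟨⟨x, hx⟩, rfl⟩
    obtain ⟨t, rfl⟩ := LinearMap.rTensor_surjective V hsurj v
    refine ⟨(LinearMap.ker d₀).subtype.rTensor V t, ?_, ?_⟩
    · rw [← LinearMap.comp_apply, ← LinearMap.rTensor_comp, LinearMap.comp_ker_subtype,
        LinearMap.rTensor_zero, LinearMap.zero_apply]
    · rw [← LinearMap.comp_apply, ← LinearMap.rTensor_comp]

theorem lTensor (h : IsHomologyClass d₁ d₀ ρ) :
    IsHomologyClass (d₁.lTensor V) (d₀.lTensor V) (ρ.lTensor V) where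
  d_d y := by
    rw [← LinearMap.comp_apply, ← LinearMap.lTensor_comp, show d₀ ∘ₗ d₁ = 0 from
      LinearMap.ext h.d_d, LinearMap.lTensor_zero, LinearMap.zero_apply]
  map_d y := by
    rw [← LinearMap.comp_apply, ← LinearMap.lTensor_comp, show ρ ∘ₗ d₁ = 0 from
      LinearMap.ext h.map_d, LinearMap.lTensor_zero, LinearMap.zero_apply]
  exact t ht hρ := by
    rw [← LinearMap.comm_comp_rTensor_comp_comm_eq] at ht hρ
    obtain ⟨y, hy⟩ := (h.rTensor V).exact (TensorProduct.comm k V X₀ t)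
      ((TensorProduct.comm k _ _).map_eq_zero_iff.1 ht)
      ((TensorProduct.comm k _ _).map_eq_zero_iff.1 hρ)
    refine ⟨(TensorProduct.comm k V X₁).symm y, ?_⟩
    rw [← LinearMap.comm_comp_rTensor_comp_comm_eq]
    simp [hy]
  surjective v := by
    obtain ⟨x, hx, hv⟩ := (h.rTensor V).surjective (TensorProduct.comm k V H v)
    refine ⟨(TensorProduct.comm k V X₀).symm x, ?_, ?_⟩
    · rw [← LinearMap.comm_comp_rTensor_comp_comm_eq]
      simp [hx]
    · rw [← LinearMap.comm_comp_rTensor_comp_comm_eq]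
      simp [hv]

end IsHomologyClass

theorem d_sub_one_eq_zero_iff {k : Type u} [CommRing k] (A : ChainComplex (ModuleCat.{u} k) ℕ)
    (q : ℕ) (x : A.X q) : (A.d q (q - 1)).hom x = 0 ↔ ∀ j, (A.d q j).hom x = 0 := by
  refine ⟨fun h j => ?_, fun h => h _⟩
  by_cases hj : j + 1 = q
  · subst hj; exact h
  · rw [A.shape _ _ hj]
    rfl

/-- Over a field the homology class of cycles extends to a linear map on all chains. In degree
`0` the map `A.d 0 (0 - 1)` is zero, so that every chain is a cycle there. -/
theorem exists_isHomologyClass {k : Type u} [Field k] (A : ChainComplex (ModuleCat.{u} k) ℕ)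
    (q : ℕ) : ∃ ρ : A.X q →ₗ[k] A.homology q,
      IsHomologyClass (A.d (q + 1) q).hom (A.d q (q - 1)).hom ρ := by
  obtain ⟨s, hs⟩ := (A.iCycles q).hom.exists_leftInverse_of_injective
    (LinearMap.ker_eq_bot.2 (iCycles_injective A q))
  have hs' : ∀ z, s ((A.iCycles q).hom z) = z := fun z => congrArg (fun f => f z) hs
  refine ⟨(A.homologyπ q).hom ∘ₗ s, fun y => d_d_apply A _ _ _ y, fun y => ?_,
    fun x hx hρ => ?_, fun h => ?_⟩
  · obtain ⟨z, hz⟩ := exists_iCycles_eq A q ((A.d (q + 1) q).hom y)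
      (fun j => d_d_apply A _ _ _ y)
    rw [LinearMap.comp_apply, ← hz, hs', homologyπ_eq_zero_iff, hz]
    exact ⟨_, y, rfl⟩
  · obtain ⟨z, rfl⟩ := exists_iCycles_eq A q x ((d_sub_one_eq_zero_iff A q x).1 hx)
    rw [LinearMap.comp_apply, hs', homologyπ_eq_zero_iff] at hρ
    obtain ⟨j, y, hy⟩ := hρ
    by_cases hj : j = q + 1
    · subst hj; exact ⟨y, hy⟩
    · rw [A.shape _ _ (fun h => hj h.symm)] at hy
      exact ⟨0, by rw [map_zero]; exact hy⟩
  · obtain ⟨z, rfl⟩ := homologyπ_surjective A q h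
    exact ⟨(A.iCycles q).hom z, d_iCycles_apply A _ _ z, by rw [LinearMap.comp_apply, hs']⟩

end HomologyClass

/-! ### The second page for tensor products of complexes -/

section SecondPage

variable {k : Type u} [Field k]

/-- An identification of the graded pieces of a filtered complex with the tensor products
`A_q ⊗ V_p` of two complexes, under which `d` induces `d ⊗ 1` on `E⁰` and, up to a sign, `1 ⊗ d`
on `E¹`. The condition on `E¹` is stated on the generators `a ⊗ v`, with `a` a cycle, and modulo
boundaries of `A`, that is, after any `ρ` which vanishes on them. -/
structure TensorGrading (C : ChainComplex (ModuleCat.{u} k) ℕ)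
    (F : ℤ → ∀ i : ℕ, Submodule k (C.X i)) (A V : ChainComplex (ModuleCat.{u} k) ℕ) where
  /-- the class in the graded piece, meaningful on `F_p` -/
  gr (p q : ℕ) : C.X (p + q) →ₗ[k] (A.X q) ⊗[k] (V.X p)
  /-- the sign by which the differential of `E¹` differs from `1 ⊗ d` -/
  sign : ℕ → k
  sign_ne_zero : ∀ q, sign q ≠ 0
  surjective : ∀ (p q : ℕ) (t), ∃ x ∈ F p (p + q), gr p q x = t
  gr_eq_zero_iff : ∀ (p q : ℕ), ∀ x ∈ F p (p + q), gr p q x = 0 ↔ x ∈ F (p - 1) (p + q)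
  gr_d : ∀ (p q : ℕ), ∀ x ∈ F p (p + (q + 1)),
    gr p q ((C.d (p + (q + 1)) (p + q)).hom x) =
      (A.d (q + 1) q).hom.rTensor (V.X p) (gr p (q + 1) x)
  exists_lift : ∀ (p q : ℕ) (a : A.X q) (v : V.X (p + 1)), (A.d q (q - 1)).hom a = 0 →
    ∃ x ∈ F (p + 1 : ℕ) (p + 1 + q), gr (p + 1) q x = a ⊗ₜ v ∧
      ∀ (ρ : A.X q →ₗ[k] A.homology q), (∀ y, ρ ((A.d (q + 1) q).hom y) = 0) →
        ρ.rTensor (V.X p) (gr p q ((C.d (p + 1 + q) (p + q)).hom x)) =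
          sign q • ρ a ⊗ₜ[k] (V.d (p + 1) p).hom v

namespace TensorGrading

variable {C : ChainComplex (ModuleCat.{u} k) ℕ} {F : ℤ → ∀ i : ℕ, Submodule k (C.X i)}
  {A V : ChainComplex (ModuleCat.{u} k) ℕ} (T : TensorGrading C F A V)
  (hF : IsBoundedFiltration C F)

include hF in
/-- The elements of `Z¹_p` are those whose class in `A_q ⊗ V_p` is killed by `d ⊗ 1`. -/
theorem d_mem_sub_one_iff (p q : ℕ) (x : C.X (p + q)) (hx : x ∈ F p (p + q)) :
    (∀ j, (C.d (p + q) j).hom x ∈ F (p - 1) j) ↔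
      (A.d q (q - 1)).hom.rTensor (V.X p) (T.gr p q x) = 0 := by
  cases q with
  | zero =>
    rw [A.shape _ _ (by simp)]
    refine iff_of_true (fun j => ?_) ?_
    · by_cases hj : j + 1 = p
      · rw [hF.eq_top _ _ (by lia)]
        trivial
      · rw [C.shape _ _ (by exact hj)]
        exact zero_mem _
    · rw [show (0 : A.X 0 ⟶ A.X (0 - 1)).hom = 0 from rfl, LinearMap.rTensor_zero,
        LinearMap.zero_apply]
  | succ q =>
    change _ ↔ (A.d (q + 1) q).hom.rTensor (V.X p) (T.gr p (q + 1) x) = 0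
    rw [← T.gr_d p q x hx, T.gr_eq_zero_iff p q _ (hF.d_mem _ _ _ _ hx)]
    refine ⟨fun h => h _, fun h j => ?_⟩
    by_cases hj : j = p + q
    · subst hj; exact h
    · rw [C.shape _ _ (fun h => hj (by have : j + 1 = _ := h; lia))]
      exact zero_mem _

variable {q : ℕ} {ρ : A.X q →ₗ[k] A.homology q}
  (hρ : IsHomologyClass (A.d (q + 1) q).hom (A.d q (q - 1)).hom ρ)

include hρ

theorem rTensor_gr_d_eq_zero (p i : ℕ) (hi : i = p + q + 1) (y : C.X i) (hy : y ∈ F p i) :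
    ρ.rTensor (V.X p) (T.gr p q ((C.d i (p + q)).hom y)) = 0 := by
  subst hi
  have := T.gr_d p q y hy
  exact (congrArg _ this).trans ((hρ.rTensor (V.X p)).map_d _)

include hF in
theorem exists_sub_d_mem (p i : ℕ) (hi : i = p + q + 1) (x : C.X (p + q)) (hx : x ∈ F p (p + q))
    (hdx : ∀ j, (C.d (p + q) j).hom x ∈ F (p - 1) j)
    (h : ρ.rTensor (V.X p) (T.gr p q x) = 0) :
    ∃ y ∈ F p i, x - (C.d i (p + q)).hom y ∈ F (p - 1) (p + q) := by
  subst hi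
  rw [T.d_mem_sub_one_iff hF p q x hx] at hdx
  obtain ⟨s, hs⟩ := (hρ.rTensor (V.X p)).exact _ hdx h
  obtain ⟨y, hy, rfl⟩ := T.surjective p (q + 1) s
  have hd := T.gr_d p q y hy
  refine ⟨y, hy, (T.gr_eq_zero_iff p q _ (sub_mem hx (hF.d_mem _ _ _ _ hy))).1 ?_⟩
  rw [map_sub, sub_eq_zero, ← hs]
  exact hd.symm

/-- The differential of `E¹ = H(A) ⊗ V` is `1 ⊗ d`, up to the sign. -/
theorem rTensor_gr_d (p : ℕ) (x : C.X (p + 1 + q)) (hx : x ∈ F (p + 1 : ℕ) (p + 1 + q))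
    (hc : (A.d q (q - 1)).hom.rTensor (V.X (p + 1)) (T.gr (p + 1) q x) = 0) :
    ρ.rTensor (V.X p) (T.gr p q ((C.d (p + 1 + q) (p + q)).hom x)) =
      T.sign q • (V.d (p + 1) p).hom.lTensor (A.homology q)
        (ρ.rTensor (V.X (p + 1)) (T.gr (p + 1) q x)) := by
  obtain ⟨t, ht⟩ := mem_range_rTensor_ker_subtype _ _ hc
  have key : ∃ x₀ ∈ F (p + 1 : ℕ) (p + 1 + q), T.gr (p + 1) q x₀ =
      (LinearMap.ker (A.d q (q - 1)).hom).subtype.rTensor (V.X (p + 1)) t ∧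
      ρ.rTensor (V.X p) (T.gr p q ((C.d (p + 1 + q) (p + q)).hom x₀)) =
      T.sign q • (V.d (p + 1) p).hom.lTensor (A.homology q)
        (ρ.rTensor (V.X (p + 1)) (T.gr (p + 1) q x₀)) := by
    clear ht
    induction t using TensorProduct.induction_on with
    | zero => exact ⟨0, zero_mem _, by simp, by simp⟩
    | tmul a v =>
      obtain ⟨x₀, h₀, h₁, h₂⟩ := T.exists_lift p q a v a.2
      refine ⟨x₀, h₀, h₁, ?_⟩
      rw [h₂ ρ hρ.map_d, h₁, LinearMap.rTensor_tmul, LinearMap.lTensor_tmul]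
    | add s t hs ht =>
      obtain ⟨x₀, h₀, h₁, h₂⟩ := hs
      obtain ⟨y₀, h₀', h₁', h₂'⟩ := ht
      refine ⟨x₀ + y₀, add_mem h₀ h₀', by rw [map_add, map_add, h₁, h₁'], ?_⟩
      simp only [map_add, h₂, h₂', smul_add]
  obtain ⟨x₀, h₀, h₁, h₂⟩ := key
  rw [ht] at h₁
  have hu : x - x₀ ∈ F p (p + 1 + q) := by
    have := (T.gr_eq_zero_iff (p + 1) q (x - x₀) (sub_mem hx h₀)).1
      (by rw [map_sub, h₁, sub_self])
    rwa [show ((p + 1 : ℕ) : ℤ) - 1 = p by push_cast; ring] at this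
  have h3 := T.rTensor_gr_d_eq_zero hρ p (p + 1 + q) (by lia) _ hu
  rw [map_sub, map_sub, map_sub, sub_eq_zero] at h3
  rw [h3, h₂, h₁]

include hF in
theorem exists_rTensor_gr_d_eq (p i : ℕ) (hi : i = p + q + 1) (y : C.X i)
    (hy : y ∈ F (p + 1 : ℕ) i) (hdy : (C.d i (p + q)).hom y ∈ F p (p + q)) :
    ∃ v, ρ.rTensor (V.X p) (T.gr p q ((C.d i (p + q)).hom y)) =
      (V.d (p + 1) p).hom.lTensor (A.homology q) v := by
  obtain rfl : i = p + 1 + q := by lia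
  refine ⟨T.sign q • ρ.rTensor (V.X (p + 1)) (T.gr (p + 1) q y), ?_⟩
  rw [map_smul]
  refine T.rTensor_gr_d hρ p y hy ((T.d_mem_sub_one_iff hF (p + 1) q y hy).1 fun j => ?_)
  by_cases hj : j = p + q
  · subst hj
    rwa [show ((p + 1 : ℕ) : ℤ) - 1 = p by push_cast; ring]
  · rw [C.shape _ _ (fun h => hj (by have : j + 1 = _ := h; lia))]
    exact zero_mem _

include hF in
theorem exists_rTensor_gr_d_eq_of_lTensor (p i : ℕ) (hi : i = p + q + 1)
    (v : (A.homology q : ModuleCat.{u} k) ⊗[k] (V.X (p + 1))) :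
    ∃ y ∈ F (p + 1 : ℕ) i, (C.d i (p + q)).hom y ∈ F p (p + q) ∧
      ρ.rTensor (V.X p) (T.gr p q ((C.d i (p + q)).hom y)) =
      (V.d (p + 1) p).hom.lTensor (A.homology q) v := by
  obtain rfl : i = p + 1 + q := by lia
  obtain ⟨t, ht, htv⟩ := (hρ.rTensor (V.X (p + 1))).surjective ((T.sign q)⁻¹ • v)
  obtain ⟨y, hy, rfl⟩ := T.surjective (p + 1) q t
  refine ⟨y, hy, ?_, ?_⟩
  · have := (T.d_mem_sub_one_iff hF (p + 1) q y hy).2 ht (p + q)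
    rwa [show ((p + 1 : ℕ) : ℤ) - 1 = p by push_cast; ring] at this
  · rw [T.rTensor_gr_d hρ p y hy ht, htv, map_smul, smul_smul,
      mul_inv_cancel₀ (T.sign_ne_zero q), one_smul]

variable {p : ℕ} {σ : V.X p →ₗ[k] V.homology p}
  (hσ : IsHomologyClass (V.d (p + 1) p).hom (V.d p (p - 1)).hom σ)

include hσ hF

/-- Each element of `H_q(A) ⊗ H_p(V)` comes from `Z²_p`: a lift to a cycle of `E¹` is represented in
`Z¹_p`, and this representative is corrected within `F_{p-1}`. -/
theorem exists_approxCycles_two (h : (A.homology q : ModuleCat.{u} k) ⊗[k] (V.homology p)) :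
    ∃ x ∈ approxCycles C F 2 p (p + q),
      σ.lTensor (A.homology q) (ρ.rTensor (V.X p) (T.gr p q x)) = h := by
  obtain ⟨v, hv, rfl⟩ := (hσ.lTensor (A.homology q)).surjective h
  obtain ⟨t, ht, rfl⟩ := (hρ.rTensor (V.X p)).surjective v
  obtain ⟨x, hx, rfl⟩ := T.surjective p q t
  have hdx := (T.d_mem_sub_one_iff hF p q x hx).2 ht
  cases p with
  | zero =>
    refine ⟨x, mem_approxCycles.2 ⟨hx, fun j => ?_⟩, rfl⟩
    have h0 := hdx j
    rw [hF.eq_bot _ _ (by lia), Submodule.mem_bot] at h0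
    rw [h0]
    exact zero_mem _
  | succ p =>
    have hp : ((p + 1 : ℕ) : ℤ) - 1 = p := by push_cast; ring
    rw [hp] at hdx
    have h1 := T.rTensor_gr_d hρ p x hx ht
    rw [show (V.d (p + 1) p).hom.lTensor (A.homology q)
      (ρ.rTensor (V.X (p + 1)) (T.gr (p + 1) q x)) = 0 from hv, smul_zero] at h1
    obtain ⟨y, hy, hxy⟩ := T.exists_sub_d_mem hF hρ p (p + 1 + q) (by lia) _ (hdx (p + q))
      (fun j => by rw [d_d_apply]; exact zero_mem _) h1
    have hy0 : T.gr (p + 1) q y = 0 :=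
      (T.gr_eq_zero_iff (p + 1) q y (hF.mono _ _ _ (by lia) hy)).2 (by rwa [hp])
    refine ⟨x - y, mem_approxCycles.2 ⟨sub_mem hx (hF.mono _ _ _ (by lia) hy), fun j => ?_⟩, ?_⟩
    · by_cases hj : j = p + q
      · subst hj
        rwa [map_sub, show ((p + 1 : ℕ) : ℤ) - 2 = p - 1 by push_cast; ring]
      · rw [C.shape _ _ (fun h => hj (by have : j + 1 = _ := h; lia))]
        exact zero_mem _
    · rw [map_sub, hy0, sub_zero]

/-- The map `Z²_p → H_q(A) ⊗ H_p(V)` has the same kernel as the projection to `E²`. -/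
theorem lTensor_rTensor_gr_eq_zero_iff (x : C.X (p + q)) (hx : x ∈ approxCycles C F 2 p (p + q)) :
    σ.lTensor (A.homology q) (ρ.rTensor (V.X p) (T.gr p q x)) = 0 ↔
      x ∈ approxBoundaries C F 2 p (p + q) := by
  obtain ⟨hx, hdx⟩ := mem_approxCycles.1 hx
  have hp : ((p + 1 : ℕ) : ℤ) = (p : ℤ) + 2 - 1 := by push_cast; ring
  rw [mem_approxBoundaries]
  constructor
  · intro h
    have hdx' : ∀ j, (C.d (p + q) j).hom x ∈ F (p - 1) j :=
      fun j => hF.mono _ _ _ (by lia) (hdx j)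
    have hc := (T.d_mem_sub_one_iff hF p q x hx).1 hdx'
    have hv : (V.d p (p - 1)).hom.lTensor (A.homology q)
        (ρ.rTensor (V.X p) (T.gr p q x)) = 0 := by
      cases p with
      | zero =>
        rw [V.shape _ _ (by simp), show (0 : V.X 0 ⟶ V.X (0 - 1)).hom = 0 from rfl,
          LinearMap.lTensor_zero, LinearMap.zero_apply]
      | succ p =>
        have h1 := T.rTensor_gr_d hρ p x hx hc
        have h2 := hdx (p + q)
        have h3 := hdx' (p + q)
        rw [show ((p + 1 : ℕ) : ℤ) - 2 = p - 1 by push_cast; ring] at h2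
        rw [show ((p + 1 : ℕ) : ℤ) - 1 = p by push_cast; ring] at h3
        rw [(T.gr_eq_zero_iff p q _ h3).2 h2, map_zero] at h1
        exact (smul_eq_zero.1 h1.symm).resolve_left (T.sign_ne_zero q)
    obtain ⟨v, hv'⟩ := (hσ.lTensor (A.homology q)).exact _ hv h
    obtain ⟨y, hy, hdy, hyv⟩ := T.exists_rTensor_gr_d_eq_of_lTensor hF hρ p _ rfl v
    obtain ⟨y', hy', hxy⟩ := T.exists_sub_d_mem hF hρ p _ rfl
      (x - (C.d (p + q + 1) (p + q)).hom y) (sub_mem hx hdy)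
      (fun j => by rw [map_sub, d_d_apply, sub_zero]; exact hdx' j)
      (by rw [map_sub, map_sub, hyv, hv', sub_self])
    refine ⟨_, hxy, y + y', ?_, ?_⟩
    · rw [← hp]
      exact add_mem hy (hF.mono _ _ _ (by lia) hy')
    · rw [map_add]
      abel
  · rintro ⟨w, hw, y, hy, rfl⟩
    rw [← hp] at hy
    have hw' : w ∈ F p (p + q) := hF.mono _ _ _ (by lia) hw
    obtain ⟨v, hv⟩ := T.exists_rTensor_gr_d_eq hF hρ p _ rfl y hy
      (by simpa using sub_mem hx hw')
    rw [map_add, (T.gr_eq_zero_iff p q w hw').2 hw, add_zero, hv]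
    exact (hσ.lTensor (A.homology q)).map_d v

omit hρ hσ in
include T in
/-- `E²_{p,q} = H_q(A) ⊗ H_p(V)`. -/
theorem nonempty_page_two_equiv (p q : ℕ) : Nonempty ((page C F 2).X (p, q) ≃ₗ[k]
    (A.homology q : ModuleCat.{u} k) ⊗[k] (V.homology p : ModuleCat.{u} k)) := by
  obtain ⟨ρ, hρ⟩ := exists_isHomologyClass A q
  obtain ⟨σ, hσ⟩ := exists_isHomologyClass V p
  obtain ⟨e, _⟩ := exists_linearEquiv_of_surjective (pageMk C F 2 (p, q))
    (σ.lTensor (A.homology q) ∘ₗ ρ.rTensor (V.X p) ∘ₗ T.gr p q ∘ₗ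
      (approxCycles C F 2 p (p + q)).subtype) (pageMk_surjective _ _ _ _)
    (fun h => by
      obtain ⟨x, hx, h⟩ := T.exists_approxCycles_two hF hρ hσ h
      exact ⟨⟨x, hx⟩, h⟩)
    (fun x => pageMk_eq_zero_iff.trans
      (T.lTensor_rTensor_gr_eq_zero_iff hF hρ hσ x.1 x.2).symm)
  exact ⟨e⟩

end TensorGrading

end SecondPage

/-! ### Concatenation of tensors -/

section Concat

variable {k : Type u} [CommRing k] {A A' h h' : Type u} [AddCommGroup A] [Module k A]
  [AddCommGroup A'] [Module k A'] [AddCommGroup h] [Module k h] [AddCommGroup h'] [Module k h']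

variable (k A h) in
/-- The identification `A ⊗ h^{⊗ 0} = A`. -/
def ofZero : A ≃ₗ[k] tens k A h 0 := LinearEquiv.refl k A

theorem tensMap_ofZero (φ : A →ₗ[k] A') (ψ : h →ₗ[k] h') (a : A) :
    tensMap φ ψ 0 (ofZero k A h a) = ofZero k A' h' (φ a) := rfl

variable (k A h) in
/-- `LeibnizHomology.concat` as an isomorphism. -/
def concatEquiv (s : ℕ) : ∀ r, tens k A h s ⊗[k] tens k h h r ≃ₗ[k] tens k A h (s + r + 1)
  | 0 => LinearEquiv.refl k (tens k A h s ⊗[k] h)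
  | r + 1 => (TensorProduct.assoc k (tens k A h s) (tens k h h r) h).symm ≪≫ₗ
      LinearEquiv.rTensor h (concatEquiv s r)

theorem concatEquiv_tmul (s r : ℕ) (x : tens k A h s) (w : tens k h h r) :
    concatEquiv k A h s r (x ⊗ₜ w) = concat k A h s r x w := by
  induction r with
  | zero => rfl
  | succ r ih =>
    induction w using tens_induction with
    | zero => rw [TensorProduct.tmul_zero, map_zero, map_zero]
    | add a b ha hb => rw [TensorProduct.tmul_add, map_add, ha, hb, map_add]
    | snoc a b =>
      rw [concat_succ_snoc, ← ih]
      rfl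

variable (k A h) in
/-- Concatenation `(A ⊗ h^{⊗ s}) ⊗ (h ⊗ h^{⊗ r}) ≃ A ⊗ h^{⊗ N}` for any `N` that equals
`s + r + 1`; leaving `N` free avoids transports between equal but not identical exponents. -/
def cat (s r N : ℕ) (hN : s + r + 1 = N) :
    tens k A h s ⊗[k] tens k h h r ≃ₗ[k] tens k A h N :=
  hN ▸ concatEquiv k A h s r

theorem cat_eq_concat (s r : ℕ) (x : tens k A h s) (w : tens k h h r) :
    cat k A h s r (s + r + 1) rfl (x ⊗ₜ w) = concat k A h s r x w :=
  concatEquiv_tmul s r x w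

theorem cat_snoc (s r N : ℕ) (hN : s + r + 1 = N) (x : tens k A h s) (w : tens k h h r) (b : h) :
    cat k A h s (r + 1) (N + 1) (by lia) (x ⊗ₜ snoc k h h r w b) =
      snoc k A h N (cat k A h s r N hN (x ⊗ₜ w)) b := by
  subst hN
  rw [cat_eq_concat]
  exact cat_eq_concat s (r + 1) x (snoc k h h r w b)

/-- Associativity of concatenation, for a middle factor of length one. -/
theorem cat_snoc_left (s r N : ℕ) (hN : s + 1 + r + 1 = N) (x : tens k A h s) (b : h)
    (w : tens k h h r) :
    cat k A h (s + 1) r N hN (snoc k A h s x b ⊗ₜ w) =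
      cat k A h s (r + 1) N (by lia)
        (x ⊗ₜ cat k h h 0 r (r + 1) (by lia) (ofZero k h h b ⊗ₜ w)) := by
  induction r generalizing N with
  | zero =>
    subst hN
    rfl
  | succ r ih =>
    obtain ⟨N, rfl⟩ : ∃ M, N = M + 1 := ⟨N - 1, by lia⟩
    induction w using tens_induction with
    | zero =>
      rw [TensorProduct.tmul_zero, TensorProduct.tmul_zero, map_zero, map_zero,
        TensorProduct.tmul_zero, map_zero]
    | add a c ha hc =>
      rw [TensorProduct.tmul_add, TensorProduct.tmul_add, map_add, map_add,
        TensorProduct.tmul_add, map_add, ha, hc]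
    | snoc a c =>
      rw [cat_snoc (s + 1) r N (by lia), ih, cat_snoc 0 r (r + 1) (by lia),
        cat_snoc s (r + 1) N (by lia)]

theorem tensMap_cat (φ : A →ₗ[k] A') (ψ : h →ₗ[k] h') (s r N : ℕ) (hN : s + r + 1 = N)
    (t : tens k A h s ⊗[k] tens k h h r) :
    tensMap φ ψ N (cat k A h s r N hN t) =
      cat k A' h' s r N hN (TensorProduct.map (tensMap φ ψ s) (tensMap ψ ψ r) t) := by
  subst hN
  induction t using TensorProduct.induction_on with
  | zero => simp only [map_zero]
  | add a b ha hb => simp only [map_add, ha, hb]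
  | tmul x w => rw [cat_eq_concat, tensMap_concat, TensorProduct.map_tmul, cat_eq_concat]

theorem tensMap_surjective (φ : A →ₗ[k] A') (ψ : h →ₗ[k] h') (hφ : Function.Surjective φ)
    (hψ : Function.Surjective ψ) (n : ℕ) : Function.Surjective (tensMap φ ψ n) := by
  induction n with
  | zero => exact hφ
  | succ n ih =>
    intro y
    induction y using tens_induction with
    | zero => exact ⟨0, map_zero _⟩
    | add a b ha hb =>
      obtain ⟨x, rfl⟩ := ha
      obtain ⟨y, rfl⟩ := hb
      exact ⟨x + y, map_add _ _ _⟩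
    | snoc a b =>
      obtain ⟨x, rfl⟩ := ih a
      obtain ⟨y, rfl⟩ := hψ b
      exact ⟨snoc k A h n x y, tensMap_snoc _ _ _ _ _⟩

/-- `φ ⊗ ψ^{⊗ n} = (φ ⊗ 1) ∘ (1 ⊗ ψ^{⊗ n})`. -/
theorem tensMap_tensMap (φ : A →ₗ[k] A') (ψ : h →ₗ[k] h') (n : ℕ) (x : tens k A h n) :
    tensMap φ LinearMap.id n (tensMap LinearMap.id ψ n x) = tensMap φ ψ n x := by
  induction n with
  | zero => rfl
  | succ n ih =>
    induction x using tens_induction with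
    | zero => simp only [map_zero]
    | add a b ha hb => simp only [map_add, ha, hb]
    | snoc a b => rw [tensMap_snoc, tensMap_snoc, tensMap_snoc, ih]; rfl

end Concat

/-! ### The boundary of a concatenation -/

section ActSum

variable {k : Type u} [CommRing k] {h h' : Type u} [AddCommGroup h] [Module k h]
  [AddCommGroup h'] [Module k h'] {X Y : Type u} [AddCommGroup X] [Module k X]
  [AddCommGroup Y] [Module k Y]

/-- `w₀ ⊗ ⋯ ⊗ w_{r+1} ↦ ∑_j (-1)^j α(w_j) ⊗ (w₀ ⊗ ⋯ ŵ_j ⋯ ⊗ w_{r+1})`. For `α b = [b, x]` these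
are the terms of the boundary of `x ⊗ w` in which a factor of `w` acts on `x`. -/
def actSum (α : h →ₗ[k] X) : ∀ r, tens k h h (r + 1) →ₗ[k] X ⊗[k] tens k h h r
  | 0 => tensLift ((((TensorProduct.mk k X (tens k h h 0)).compl₁₂ α (ofZero k h h).toLinearMap) -
      ((TensorProduct.mk k X (tens k h h 0)).compl₁₂ α (ofZero k h h).toLinearMap).flip) ∘ₗ
      (ofZero k h h).symm.toLinearMap)
  | r + 1 => tensLift ((LinearMap.lTensorHom X ∘ₗ (snoc k h h r).flip).flip ∘ₗ actSum α r +
      (-1 : k) ^ (r + 2) • (TensorProduct.mk k X (tens k h h (r + 1)) ∘ₗ α).flip)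

theorem actSum_zero_snoc (α : h →ₗ[k] X) (b c : h) :
    actSum α 0 (snoc k h h 0 (ofZero k h h b) c) =
      α b ⊗ₜ[k] ofZero k h h c - α c ⊗ₜ[k] ofZero k h h b := rfl

theorem actSum_succ_snoc (α : h →ₗ[k] X) (r : ℕ) (w : tens k h h (r + 1)) (c : h) :
    actSum α (r + 1) (snoc k h h (r + 1) w c) =
      ((snoc k h h r).flip c).lTensor X (actSum α r w) + (-1 : k) ^ (r + 2) • α c ⊗ₜ[k] w := rfl

theorem lTensor_tensMap_actSum (α : h →ₗ[k] X) (α' : h' →ₗ[k] X) (ψ : h →ₗ[k] h')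
    (hα : ∀ b, α' (ψ b) = α b) (r : ℕ) (w : tens k h h (r + 1)) :
    (tensMap ψ ψ r).lTensor X (actSum α r w) = actSum α' r (tensMap ψ ψ (r + 1) w) := by
  induction r with
  | zero =>
    induction w using tens_induction with
    | zero => simp only [map_zero]
    | add a b ha hb => simp only [map_add, ha, hb]
    | snoc b c =>
      obtain ⟨b, rfl⟩ := (ofZero k h h).surjective b
      rw [actSum_zero_snoc, map_sub, LinearMap.lTensor_tmul, LinearMap.lTensor_tmul, tensMap_snoc,
        tensMap_ofZero, tensMap_ofZero, actSum_zero_snoc, hα, hα]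
  | succ r ih =>
    induction w using tens_induction with
    | zero => simp only [map_zero]
    | add a b ha hb => simp only [map_add, ha, hb]
    | snoc w c =>
      rw [actSum_succ_snoc, map_add, tensMap_snoc, actSum_succ_snoc, map_smul,
        LinearMap.lTensor_tmul, hα, ← ih]
      congr 1
      rw [← LinearMap.lTensor_comp_apply, ← LinearMap.lTensor_comp_apply]
      rfl

theorem rTensor_actSum_eq_zero (α : h →ₗ[k] X) (ρ : X →ₗ[k] Y) (hρ : ∀ b, ρ (α b) = 0) (r : ℕ)
    (w : tens k h h (r + 1)) : ρ.rTensor (tens k h h r) (actSum α r w) = 0 := by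
  induction r with
  | zero =>
    induction w using tens_induction with
    | zero => simp only [map_zero]
    | add a b ha hb => simp only [map_add, ha, hb, add_zero]
    | snoc b c =>
      obtain ⟨b, rfl⟩ := (ofZero k h h).surjective b
      rw [actSum_zero_snoc, map_sub, LinearMap.rTensor_tmul, LinearMap.rTensor_tmul, hρ, hρ,
        TensorProduct.zero_tmul, TensorProduct.zero_tmul, sub_zero]
  | succ r ih =>
    induction w using tens_induction with
    | zero => simp only [map_zero]
    | add a b ha hb => simp only [map_add, ha, hb, add_zero]
    | snoc w c =>
      rw [actSum_succ_snoc, map_add, map_smul, LinearMap.rTensor_tmul, hρ,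
        TensorProduct.zero_tmul, smul_zero, add_zero, ← LinearMap.comp_apply,
        LinearMap.rTensor_comp_lTensor, ← LinearMap.lTensor_comp_rTensor, LinearMap.comp_apply,
        ih, map_zero]

end ActSum

section BoundaryConcat

variable {k : Type u} [CommRing k] {A h : Type u} [AddCommGroup A] [Module k A]
  [AddCommGroup h] [Module k h] {H : LeibnizAlgebra k h}

/-- A Leibniz algebra as an anti-symmetric co-representation of itself, with left action
`-[x, a]`. -/
def adjointCoRep (H : LeibnizAlgebra k h) : CoRepresentation H h where
  left := -H.bracket.flip
  right := 0
  left_bracket x y m := by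
    have h2 : H.bracket m (H.bracket x y) =
        H.bracket (H.bracket m x) y - H.bracket (H.bracket m y) x := by
      rw [H.leibniz m x y]; abel
    simp only [LinearMap.neg_apply, LinearMap.flip_apply, h2, map_neg, neg_neg]
    abel
  left_right x y m := by simp
  right_right x y m := by simp

theorem leftAct_cat (M : CoRepresentation H A) (s r N : ℕ) (hN : s + r + 1 = N) (b : h)
    (x : tens k A h s) (w : tens k h h r) :
    leftAct M N b (cat k A h s r N hN (x ⊗ₜ w)) =
      cat k A h s r N hN (leftAct M s b x ⊗ₜ w) +
      cat k A h s r N hN (x ⊗ₜ leftAct (adjointCoRep H) r b w) := by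
  subst hN
  induction r with
  | zero =>
    obtain ⟨w, rfl⟩ := (ofZero k h h).surjective w
    change leftAct M (s + 1) b (snoc k A h s x w) =
      snoc k A h s (leftAct M s b x) w + snoc k A h s x (-(H.bracket w b))
    rw [leftAct_snoc, map_neg, sub_eq_add_neg]
  | succ r ih =>
    induction w using tens_induction with
    | zero => simp only [TensorProduct.tmul_zero, map_zero, add_zero]
    | add a c ha hc =>
      simp only [TensorProduct.tmul_add, map_add, ha, hc]
      abel
    | snoc w c =>
      have hc := fun x w => cat_snoc (k := k) (A := A) (h := h) s r (s + r + 1) rfl x w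
      change leftAct M (s + r + 1 + 1) b (cat k A h s (r + 1) (s + r + 1 + 1) _ _) =
        cat k A h s (r + 1) (s + r + 1 + 1) _ _ + cat k A h s (r + 1) (s + r + 1 + 1) _ _
      rw [hc, hc, leftAct_snoc, ih, leftAct_snoc, TensorProduct.tmul_sub, map_sub, hc, hc, map_add,
        LinearMap.add_apply]
      abel

/-- `x ⊗ w ↦ d x ⊗ w`, which is zero for `s = 0`. -/
def catBoundary (M : CoRepresentation H A) : ∀ (s r N : ℕ) (_ : s + r = N),
    tens k A h s ⊗[k] tens k h h r →ₗ[k] tens k A h N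
  | 0, _, _, _ => 0
  | s + 1, r, N, hN => (cat k A h s r N (by lia)).toLinearMap ∘ₗ
      (boundary M s).rTensor (tens k h h r)

theorem catBoundary_snoc (M : CoRepresentation H A) (s r N : ℕ) (hN : s + r = N)
    (x : tens k A h s) (w : tens k h h r) (c : h) :
    catBoundary M s (r + 1) (N + 1) (by lia) (x ⊗ₜ snoc k h h r w c) =
      snoc k A h N (catBoundary M s r N hN (x ⊗ₜ w)) c := by
  cases s with
  | zero => exact (LinearMap.map_zero₂ (snoc k A h N) c).symm
  | succ s => exact cat_snoc s r N (by lia) _ w c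

theorem boundary_cat_zero (M : CoRepresentation H A) (s : ℕ) (x : tens k A h s) (b : h) :
    boundary M s (snoc k A h s x b) =
      catBoundary M s 0 s rfl (x ⊗ₜ ofZero k h h b) + (-1 : k) ^ (s + 1) • leftAct M s b x := by
  cases s with
  | zero =>
    rw [boundary_zero_snoc]
    change _ = (0 : tens k A h 0) + _
    simp
  | succ s => exact boundary_succ_snoc M s b x

/-- The boundary of a concatenation `x ⊗ w`: besides `d x ⊗ w` and, up to a sign, `x ⊗ d w`,
it consists of the terms in which a factor of `w` acts on `x`. -/
theorem boundary_cat_succ (M : CoRepresentation H A) (s r N : ℕ) (hN : s + (r + 1) = N)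
    (x : tens k A h s) (w : tens k h h (r + 1)) :
    boundary M N (cat k A h s (r + 1) (N + 1) (by lia) (x ⊗ₜ w)) =
      catBoundary M s (r + 1) N hN (x ⊗ₜ w) + (-1 : k) ^ (s + 1) •
        cat k A h s r N (by lia) (actSum ((leftAct M s).flip x) r w +
          x ⊗ₜ boundary (adjointCoRep H) r w) := by
  induction r generalizing N with
  | zero =>
    subst hN
    induction w using tens_induction with
    | zero => simp only [TensorProduct.tmul_zero, map_zero, add_zero, smul_zero]
    | add a c ha hc =>
      simp only [TensorProduct.tmul_add, map_add, ha, hc, smul_add]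
      abel
    | snoc b c =>
      obtain ⟨b, rfl⟩ := (ofZero k h h).surjective b
      have h1 : cat k A h s (0 + 1) (s + (0 + 1) + 1) (by lia)
          (x ⊗ₜ snoc k h h 0 (ofZero k h h b) c) =
          snoc k A h (s + 1) (snoc k A h s x b) c := rfl
      have h2 : ∀ (y : tens k A h s) (d : h), cat k A h s 0 (s + (0 + 1)) (by lia)
          (y ⊗ₜ ofZero k h h d) = snoc k A h s y d := fun _ _ => rfl
      have h3 : boundary (adjointCoRep H) 0 (snoc k h h 0 (ofZero k h h b) c) =
          ofZero k h h (H.bracket b c) := neg_neg (H.bracket b c)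
      rw [h1, catBoundary_snoc M s 0 s rfl, actSum_zero_snoc, h3, map_add, map_sub, h2, h2, h2]
      change boundary M (s + 1) (snoc k A h (s + 1) (snoc k A h s x b) c) =
        snoc k A h s _ c + _
      rw [boundary_succ_snoc, boundary_cat_zero, leftAct_snoc,
        map_add, LinearMap.add_apply, map_smul, LinearMap.smul_apply,
        pow_succ _ (s + 1), mul_neg_one, neg_smul, add_assoc, ← smul_neg, ← smul_add,
        LinearMap.flip_apply, LinearMap.flip_apply]
      congr 2
      abel
  | succ r ih =>
    obtain ⟨N, rfl⟩ : ∃ M, N = M + 1 := ⟨N - 1, by lia⟩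
    induction w using tens_induction with
    | zero => simp only [TensorProduct.tmul_zero, map_zero, add_zero, smul_zero]
    | add a c ha hc =>
      simp only [TensorProduct.tmul_add, map_add, ha, hc, smul_add]
      abel
    | snoc w c =>
      have h3 : ∀ t : tens k A h s ⊗[k] tens k h h r,
          cat k A h s (r + 1) (N + 1) (by lia) (((snoc k h h r).flip c).lTensor _ t) =
            snoc k A h N (cat k A h s r N (by lia) t) c := by
        intro t
        induction t using TensorProduct.induction_on with
        | zero => simp only [map_zero, LinearMap.zero_apply]
        | add a b ha hb => simp only [map_add, ha, hb, LinearMap.add_apply]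
        | tmul y v => exact cat_snoc s r N (by lia) y v c
      rw [cat_snoc s (r + 1) (N + 1) (by lia), catBoundary_snoc M s (r + 1) N (by lia),
        boundary_succ_snoc, ih N (by lia), leftAct_cat, actSum_succ_snoc, boundary_succ_snoc,
        TensorProduct.tmul_add, TensorProduct.tmul_smul]
      simp only [map_add, LinearMap.add_apply, map_smul, LinearMap.smul_apply, h3]
      rw [cat_snoc s r N (by lia)]
      have hs : (-1 : k) ^ (N + 2) = (-1) ^ (s + 1) * (-1) ^ (r + 2) := by
        rw [← pow_add]
        congr 1
        lia
      rw [hs]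
      simp only [smul_add, mul_smul, LinearMap.flip_apply]
      abel

end BoundaryConcat

/-! ### The filtration of the relative complex -/

theorem subComplex_d_apply {k : Type u} [CommRing k] (X : ℕ → ModuleCat.{u} k)
    (d : ∀ n, X (n + 1) →ₗ[k] X n) (hd : ∀ n x, d n (d (n + 1) x) = 0)
    (S : ∀ n, Submodule k (X n)) (hS : ∀ n, ∀ x ∈ S (n + 1), d n x ∈ S n) (n : ℕ) (x : S (n + 1)) :
    ((subComplex X d hd S hS).d (n + 1) n).hom x = (d n).restrict (hS n) x :=
  congrArg (fun f => f.hom x) (ChainComplex.of_d (fun n => ModuleCat.of k (S n))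
    (fun n => ModuleCat.ofHom ((d n).restrict (hS n))) n)

section LeftAct

variable {k : Type u} [CommRing k] {A h : Type u} [AddCommGroup A] [Module k A]
  [AddCommGroup h] [Module k h] {H : LeibnizAlgebra k h}

theorem leftAct_eq_zero (M : CoRepresentation H A) (b : h) (hM : M.left b = 0)
    (hb : ∀ a, H.bracket a b = 0) (n : ℕ) (x : tens k A h n) : leftAct M n b x = 0 := by
  induction n with
  | zero => exact congrArg (fun f => f x) hM
  | succ n ih =>
    induction x using tens_induction with
    | zero => rw [map_zero]
    | add x y hx hy => rw [map_add, hx, hy, add_zero]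
    | snoc x c =>
      rw [leftAct_snoc, ih, hb, map_zero, map_zero, LinearMap.zero_apply, sub_zero]

end LeftAct

variable {k : Type u} [Field k] {m : ℕ} {g : Type u} [AddCommGroup g] [Module k g]

theorem proj_surjective : Function.Surjective (proj k m g) := by
  rw [← LinearMap.range_eq_top, eq_top_iff, ← exteriorPower.ιMulti_span, Submodule.span_le]
  rintro _ ⟨a, rfl⟩
  exact ⟨_, proj_tprod a⟩

section Steps

variable (k m g)

/-- `g ⊗ D^{⊗ s} ⊗ ker (D^{⊗ (r+1)} → L^{⊗ (r+1)})` as a subspace of `g ⊗ D^{⊗ N}`, where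
`N = s + r + 1`, written as the kernel of the projection to `g ⊗ D^{⊗ s} ⊗ L^{⊗ (r+1)}`. -/
def step (s r N : ℕ) (hN : s + r + 1 = N) : Submodule k (tens k g (DPow k m g) N) :=
  LinearMap.ker ((tensMap (proj k m g) (proj k m g) r).lTensor (tens k g (DPow k m g) s) ∘ₗ
    (cat k g (DPow k m g) s r N hN).symm.toLinearMap)

variable {k m g}

theorem cat_mem_step {s r N : ℕ} {hN : s + r + 1 = N}
    {t : tens k g (DPow k m g) s ⊗[k] tens k (DPow k m g) (DPow k m g) r} :
    cat k g (DPow k m g) s r N hN t ∈ step k m g s r N hN ↔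
      (tensMap (proj k m g) (proj k m g) r).lTensor (tens k g (DPow k m g) s) t = 0 := by
  rw [step, LinearMap.mem_ker, LinearMap.comp_apply, LinearEquiv.coe_coe,
    LinearEquiv.symm_apply_apply]

theorem tmul_mem_step {s r N : ℕ} {hN : s + r + 1 = N} (x : tens k g (DPow k m g) s)
    {w : tens k (DPow k m g) (DPow k m g) r} (hw : tensMap (proj k m g) (proj k m g) r w = 0) :
    cat k g (DPow k m g) s r N hN (x ⊗ₜ w) ∈ step k m g s r N hN := by
  rw [cat_mem_step, LinearMap.lTensor_tmul, hw, TensorProduct.tmul_zero]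

/-- Since `k` is a field, the kernel is again spanned by the obvious tensors. -/
theorem step_le {s r N : ℕ} {hN : s + r + 1 = N} {S : Submodule k (tens k g (DPow k m g) N)}
    (hS : ∀ x w, tensMap (proj k m g) (proj k m g) r w = 0 →
      cat k g (DPow k m g) s r N hN (x ⊗ₜ w) ∈ S) : step k m g s r N hN ≤ S := by
  intro y hy
  obtain ⟨t, rfl⟩ := (cat k g (DPow k m g) s r N hN).surjective y
  rw [cat_mem_step] at hy
  obtain ⟨t, rfl⟩ := (Module.Flat.lTensor_exact (tens k g (DPow k m g) s)
    (LinearMap.exact_subtype_ker_map (tensMap (proj k m g) (proj k m g) r)) t).1 hy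
  clear hy
  induction t using TensorProduct.induction_on with
  | zero => simp only [map_zero, zero_mem]
  | add a b ha hb =>
    rw [map_add, map_add]
    exact add_mem ha hb
  | tmul x w => exact hS x w w.2

theorem step_congr {s r s' r' N : ℕ} {hN : s + r + 1 = N} (hs : s = s') (hr : r = r')
    (hN' : s' + r' + 1 = N) : step k m g s r N hN = step k m g s' r' N hN' := by
  subst hs hr
  rfl

/-- The filtration is increasing: `D ⊗ ker (D^{⊗ (r+1)} → L^{⊗ (r+1)})` lies in
`ker (D^{⊗ (r+2)} → L^{⊗ (r+2)})`. -/
theorem step_succ_le (s r N : ℕ) (hN : s + 1 + r + 1 = N) :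
    step k m g (s + 1) r N hN ≤ step k m g s (r + 1) N (by lia) := by
  refine step_le fun y w hw => ?_
  induction y using tens_induction with
  | zero => simp only [TensorProduct.zero_tmul, map_zero, zero_mem]
  | add a b ha hb =>
    rw [TensorProduct.add_tmul, map_add]
    exact add_mem ha hb
  | snoc a b =>
    rw [cat_snoc_left]
    refine tmul_mem_step a ?_
    rw [tensMap_cat, TensorProduct.map_tmul, hw, TensorProduct.tmul_zero, map_zero]

theorem step_le_ker (s r N : ℕ) (hN : s + r + 1 = N) : step k m g s r N hN ≤
    LinearMap.ker (tensMap (LinearMap.id (R := k) (M := g)) (proj k m g) N) := by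
  refine step_le fun x w hw => ?_
  rw [LinearMap.mem_ker, tensMap_cat, TensorProduct.map_tmul, hw, TensorProduct.tmul_zero,
    map_zero]

theorem ker_le_step_zero (r N : ℕ) (hN : 0 + r + 1 = N) :
    LinearMap.ker (tensMap (LinearMap.id (R := k) (M := g)) (proj k m g) N) ≤
      step k m g 0 r N hN := by
  intro y hy
  obtain ⟨t, rfl⟩ := (cat k g (DPow k m g) 0 r N hN).surjective y
  rw [LinearMap.mem_ker, tensMap_cat, LinearEquiv.map_eq_zero_iff] at hy
  rw [cat_mem_step]
  exact hy

theorem mem_block_iff (s r : ℕ) (x : tens k g (DPow k m g) (s + r + 1)) :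
    x ∈ FilippovAlgebra.block k m g r s ↔ x ∈ step k m g s r (s + r + 1) rfl := by
  suffices h : FilippovAlgebra.block k m g r s = step k m g s r (s + r + 1) rfl by rw [h]
  refine le_antisymm ?_ (step_le fun x w hw => ?_)
  · rw [FilippovAlgebra.block, Submodule.map₂_le]
    intro x _ w hw
    rw [← cat_eq_concat]
    exact tmul_mem_step x hw
  · rw [cat_eq_concat]
    exact Submodule.apply_mem_map₂ _ trivial hw

theorem mem_transport_block_iff (s r i : ℕ) (hi : s + r = i) (x : tens k g (DPow k m g) (i + 1)) :
    x ∈ (hi ▸ FilippovAlgebra.block k m g r s : Submodule k (tens k g (DPow k m g) (i + 1))) ↔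
      x ∈ step k m g s r (i + 1) (by lia) := by
  subst hi
  exact mem_block_iff s r x

variable (k m g) in
/-- `(g ⊗ D^{⊗ (s+1)}) ⊗ L^{⊗ (r+1)} ≃ (g ⊗ D^{⊗ s}) ⊗ (D ⊗ L^{⊗ (r+1)})`. -/
def shiftEquiv (s r : ℕ) :
    tens k g (DPow k m g) (s + 1) ⊗[k] tens k (LPow k m g) (LPow k m g) r ≃ₗ[k]
      tens k g (DPow k m g) s ⊗[k] tens k (DPow k m g) (LPow k m g) (r + 1) :=
  TensorProduct.assoc k (tens k g (DPow k m g) s) (DPow k m g) _ ≪≫ₗ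
    LinearEquiv.lTensor _ (LinearEquiv.rTensor _ (ofZero k (DPow k m g) (LPow k m g)) ≪≫ₗ
      cat k (DPow k m g) (LPow k m g) 0 r (r + 1) (by lia))

/-- The kernel of `g ⊗ D^{⊗ s} ⊗ D^{⊗ (r+2)} → g ⊗ D^{⊗ s} ⊗ D ⊗ L^{⊗ (r+1)}` is the next smaller
step of the filtration. -/
theorem mem_step_succ_iff (s r N : ℕ) (hN : s + (r + 1) + 1 = N) (x : tens k g (DPow k m g) N) :
    x ∈ step k m g (s + 1) r N (by lia) ↔
      (tensMap LinearMap.id (proj k m g) (r + 1)).lTensor (tens k g (DPow k m g) s)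
        ((cat k g (DPow k m g) s (r + 1) N hN).symm x) = 0 := by
  have key : ∀ t, (tensMap LinearMap.id (proj k m g) (r + 1)).lTensor (tens k g (DPow k m g) s)
      ((cat k g (DPow k m g) s (r + 1) N hN).symm
        (cat k g (DPow k m g) (s + 1) r N (by lia) t)) =
      shiftEquiv k m g s r ((tensMap (proj k m g) (proj k m g) r).lTensor _ t) := by
    intro t
    induction t using TensorProduct.induction_on with
    | zero => simp only [map_zero]
    | add a b ha hb => simp only [map_add, ha, hb]
    | tmul y w =>
      induction y using tens_induction with
      | zero => simp only [TensorProduct.zero_tmul, map_zero]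
      | add a b ha hb => simp only [TensorProduct.add_tmul, map_add, ha, hb]
      | snoc a b =>
        rw [cat_snoc_left, LinearEquiv.symm_apply_apply, LinearMap.lTensor_tmul, tensMap_cat]
        rfl
  obtain ⟨t, rfl⟩ := (cat k g (DPow k m g) (s + 1) r N (by lia)).surjective x
  rw [key, cat_mem_step, LinearEquiv.map_eq_zero_iff]

end Steps

namespace FilippovAlgebra

variable (G : FilippovAlgebra k m g)

theorem leftAct_eq_zero_of_proj_eq_zero (s : ℕ) (b : DPow k m g) (hb : proj k m g b = 0)
    (x : tens k g (DPow k m g) s) : leftAct G.coRepD s b x = 0 := by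
  have h0 : G.adD b = 0 := by rw [← adL_proj, hb, map_zero]
  refine leftAct_eq_zero G.coRepD b (neg_eq_zero.2 h0) (fun a => ?_) s x
  change derD (G.adD b) a = 0
  rw [h0, map_zero, LinearMap.zero_apply]

theorem tensMap_proj_boundary (r : ℕ) (w : tens k (DPow k m g) (DPow k m g) (r + 1)) :
    tensMap (proj k m g) (proj k m g) r (boundary (adjointCoRep G.leibnizD) r w) =
      boundary (adjointCoRep G.leibnizL) r (tensMap (proj k m g) (proj k m g) (r + 1) w) := by
  refine tensMap_boundary _ _ _ _ G.proj_bracket (fun a v => ?_) r w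
  change proj k m g (-(G.leibnizD.bracket v a)) =
    -(G.leibnizL.bracket (proj k m g v) (proj k m g a))
  rw [map_neg, G.proj_bracket]

theorem tensMap_id_boundary (r : ℕ) (w : tens k (DPow k m g) (DPow k m g) (r + 1)) :
    tensMap LinearMap.id (proj k m g) r (boundary (adjointCoRep G.leibnizD) r w) =
      boundary G.coRepLD r (tensMap LinearMap.id (proj k m g) (r + 1) w) := by
  refine tensMap_boundary _ _ _ _ G.proj_bracket (fun a v => ?_) r w
  change -(derD (G.adD a) v) = derD (-(G.adL (proj k m g a))) v
  rw [adL_proj, map_neg, LinearMap.neg_apply]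

/-- The action of `D` on `g ⊗ D^{⊗ s}` factors through `L`, so that the terms in which a factor of
`w` acts on `x` lie in `g ⊗ D^{⊗ s} ⊗ ker (D^{⊗ (r+1)} → L^{⊗ (r+1)})` along with `w`. -/
theorem lTensor_actSum_eq_zero (s r : ℕ) (x : tens k g (DPow k m g) s)
    (w : tens k (DPow k m g) (DPow k m g) (r + 1))
    (hw : tensMap (proj k m g) (proj k m g) (r + 1) w = 0) :
    (tensMap (proj k m g) (proj k m g) r).lTensor _
      (actSum ((leftAct G.coRepD s).flip x) r w) = 0 := by
  obtain ⟨j, hj⟩ := (proj k m g).exists_rightInverse_of_surjective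
    (LinearMap.range_eq_top.2 proj_surjective)
  rw [lTensor_tensMap_actSum _ ((leftAct G.coRepD s).flip x ∘ₗ j), hw, map_zero]
  intro b
  rw [← sub_eq_zero, LinearMap.comp_apply, ← map_sub]
  refine G.leftAct_eq_zero_of_proj_eq_zero s _ ?_ x
  rw [map_sub, sub_eq_zero]
  exact congrArg (fun f => f (proj k m g b)) hj

theorem actSum_add_boundary_mem (s r N : ℕ) (hN : s + 1 + r = N)
    (x : tens k g (DPow k m g) s)
    (w : tens k (DPow k m g) (DPow k m g) (r + 1))
    (hw : tensMap (proj k m g) (proj k m g) (r + 1) w = 0) :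
    cat k g (DPow k m g) s r N (by lia) (actSum ((leftAct G.coRepD s).flip x) r w +
      x ⊗ₜ boundary (adjointCoRep G.leibnizD) r w) ∈ step k m g s r N (by lia) := by
  rw [cat_mem_step, map_add, G.lTensor_actSum_eq_zero s r x w hw, LinearMap.lTensor_tmul,
    tensMap_proj_boundary, hw, map_zero, TensorProduct.tmul_zero, add_zero]

/-- On `g ⊗ D^{⊗ (s+1)} ⊗ ker (D^{⊗ (r+1)} → L^{⊗ (r+1)})` the boundary is `d ⊗ 1` up to terms in
the next smaller step of the filtration, which vanish in `g ⊗ D^{⊗ s} ⊗ D ⊗ L^{⊗ r}`. -/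
theorem lTensor_boundary (s r N : ℕ) (hN : s + 1 + r = N)
    (y : tens k g (DPow k m g) (N + 1)) (hy : y ∈ step k m g (s + 1) r (N + 1) (by lia)) :
    (tensMap LinearMap.id (proj k m g) r).lTensor (tens k g (DPow k m g) s)
      ((cat k g (DPow k m g) s r N (by lia)).symm (boundary G.coRepD N y)) =
    (boundary G.coRepD s).rTensor _ ((tensMap LinearMap.id (proj k m g) r).lTensor
      (tens k g (DPow k m g) (s + 1)) ((cat k g (DPow k m g) (s + 1) r (N + 1) (by lia)).symm y)) ∧
    boundary G.coRepD N y ∈ step k m g s r N (by lia) := by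
  refine step_le (S := LinearMap.eqLocus
    ((tensMap LinearMap.id (proj k m g) r).lTensor (tens k g (DPow k m g) s) ∘ₗ
      (cat k g (DPow k m g) s r N (by lia)).symm.toLinearMap ∘ₗ boundary G.coRepD N)
    ((boundary G.coRepD s).rTensor _ ∘ₗ (tensMap LinearMap.id (proj k m g) r).lTensor
      (tens k g (DPow k m g) (s + 1)) ∘ₗ
        (cat k g (DPow k m g) (s + 1) r (N + 1) (by lia)).symm.toLinearMap) ⊓
    (step k m g s r N (by lia)).comap (boundary G.coRepD N)) (fun x w hw => ?_) hy
  suffices h : ∃ v, boundary G.coRepD N (cat k g (DPow k m g) (s + 1) r (N + 1) (by lia)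
        (x ⊗ₜ w)) = cat k g (DPow k m g) s r N (by lia) (boundary G.coRepD s x ⊗ₜ w) + v ∧
      (tensMap LinearMap.id (proj k m g) r).lTensor (tens k g (DPow k m g) s)
        ((cat k g (DPow k m g) s r N (by lia)).symm v) = 0 ∧
      v ∈ step k m g s r N (by lia) by
    obtain ⟨v, h1, h2, h3⟩ := h
    refine ⟨?_, ?_⟩
    · change (tensMap LinearMap.id (proj k m g) r).lTensor (tens k g (DPow k m g) s)
        ((cat k g (DPow k m g) s r N (by lia)).symm (boundary G.coRepD N
          (cat k g (DPow k m g) (s + 1) r (N + 1) (by lia) (x ⊗ₜ w)))) =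
        (boundary G.coRepD s).rTensor _ ((tensMap LinearMap.id (proj k m g) r).lTensor
          (tens k g (DPow k m g) (s + 1)) ((cat k g (DPow k m g) (s + 1) r (N + 1)
            (by lia)).symm (cat k g (DPow k m g) (s + 1) r (N + 1) (by lia) (x ⊗ₜ w))))
      rw [h1, map_add, map_add, h2, add_zero, LinearEquiv.symm_apply_apply,
        LinearEquiv.symm_apply_apply, LinearMap.lTensor_tmul, LinearMap.lTensor_tmul,
        LinearMap.rTensor_tmul]
    · change boundary G.coRepD N _ ∈ step k m g s r N (by lia)
      rw [h1]
      exact add_mem (tmul_mem_step _ hw) h3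
  cases r with
  | zero =>
    obtain ⟨b, rfl⟩ := (ofZero k (DPow k m g) (DPow k m g)).surjective w
    subst hN
    refine ⟨0, ?_, by simp only [map_zero], zero_mem _⟩
    change boundary G.coRepD (s + 1) (snoc k g (DPow k m g) (s + 1) x b) = _
    rw [boundary_cat_zero, G.leftAct_eq_zero_of_proj_eq_zero (s + 1) b hw, smul_zero]
    rfl
  | succ r =>
    have h1 := G.actSum_add_boundary_mem (s + 1) r N (by lia) x w hw
    refine ⟨_, boundary_cat_succ G.coRepD (s + 1) r N (by lia) x w, ?_, ?_⟩
    · refine (mem_step_succ_iff s r N (by lia) _).1 (Submodule.smul_mem _ _ h1)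
    · exact Submodule.smul_mem _ _ (step_succ_le s r N (by lia) h1)

section Complexes

/-- The inclusion of the `i`-th term of the relative complex into `g ⊗ D^{⊗ (i+1)}`. -/
def relVal (i : ℕ) : G.complexRel.X i →ₗ[k] tens k g (DPow k m g) (i + 1) :=
  Submodule.subtype (LinearMap.ker (tensMap (LinearMap.id (R := k) (M := g)) (proj k m g) (i + 1)))

theorem relVal_injective (i : ℕ) : Function.Injective (G.relVal i) :=
  Submodule.subtype_injective _

theorem exists_relVal_eq (i : ℕ) (x : tens k g (DPow k m g) (i + 1))
    (hx : tensMap (LinearMap.id (R := k) (M := g)) (proj k m g) (i + 1) x = 0) :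
    ∃ y, G.relVal i y = x := ⟨⟨x, hx⟩, rfl⟩

theorem tensMap_relVal (i : ℕ) (x : G.complexRel.X i) :
    tensMap (LinearMap.id (R := k) (M := g)) (proj k m g) (i + 1) (G.relVal i x) = 0 := x.2

theorem relVal_d (i : ℕ) (x : G.complexRel.X (i + 1)) :
    G.relVal i ((G.complexRel.d (i + 1) i).hom x) =
      boundary G.coRepD (i + 1) (G.relVal (i + 1) x) := by
  exact congrArg (G.relVal i) (subComplex_d_apply _ _ _ _ _ i x)

/-- The inclusion of `ker (D ⊗ L^{⊗ i} → L^{⊗ (i+1)})` into `D ⊗ L^{⊗ i}`. -/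
def drVal (i : ℕ) : G.complexDR.X i →ₗ[k] tens k (DPow k m g) (LPow k m g) i :=
  Submodule.subtype
    (LinearMap.ker (tensMap (proj k m g) (LinearMap.id (R := k) (M := LPow k m g)) i))

theorem drVal_injective (i : ℕ) : Function.Injective (G.drVal i) :=
  Submodule.subtype_injective _

theorem exists_drVal_eq (i : ℕ) (x : tens k (DPow k m g) (LPow k m g) i)
    (hx : tensMap (proj k m g) (LinearMap.id (R := k) (M := LPow k m g)) i x = 0) :
    ∃ y, G.drVal i y = x := ⟨⟨x, hx⟩, rfl⟩

theorem tensMap_drVal (i : ℕ) (x : G.complexDR.X i) :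
    tensMap (proj k m g) (LinearMap.id (R := k) (M := LPow k m g)) i (G.drVal i x) = 0 := x.2

theorem drVal_d (i : ℕ) (x : G.complexDR.X (i + 1)) :
    G.drVal i ((G.complexDR.d (i + 1) i).hom x) = boundary G.coRepLD i (G.drVal (i + 1) x) := by
  exact congrArg (G.drVal i) (subComplex_d_apply _ _ _ _ _ i x)

theorem complexHL_d (i : ℕ) :
    (G.complexHL.d (i + 1) i).hom = boundary G.coRepD i := by
  exact congrArg ModuleCat.Hom.hom (ChainComplex.of_d (fun n => tens k g (DPow k m g) n)
    (fun n => ModuleCat.ofHom (boundary G.coRepD n)) i)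

end Complexes

section Filtration

theorem mem_filtration_iff (p q i : ℕ) (hi : p + q = i) (x : G.complexRel.X i) :
    x ∈ G.filtration p i ↔ G.relVal i x ∈ step k m g q p (i + 1) (by lia) := by
  rw [← step_congr (s := i - p) (r := min i p) (hN := by lia) (by lia) (by lia)]
  exact mem_transport_block_iff _ _ _ _ _

theorem filtration_eq_bot (p : ℤ) (i : ℕ) (hp : p < 0) : G.filtration p i = ⊥ := by
  obtain ⟨n, rfl⟩ := Int.eq_negSucc_of_lt_zero hp
  rfl

theorem filtration_eq_top (p : ℤ) (i : ℕ) (hp : (i : ℤ) ≤ p) : G.filtration p i = ⊤ := by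
  obtain ⟨p, rfl⟩ := Int.eq_ofNat_of_zero_le (le_trans (Int.natCast_nonneg i) hp)
  rw [eq_top_iff]
  intro x _
  have h : G.relVal i x ∈ step k m g (i - p) (min i p) (i + 1) (by lia) := by
    rw [step_congr (s' := 0) (r' := i) (by lia) (by lia) (by lia)]
    exact ker_le_step_zero i (i + 1) (by lia) (G.tensMap_relVal i x)
  exact (mem_transport_block_iff _ _ _ (Nat.sub_add_min_cancel i p) _).2 h

theorem filtration_le_succ (p : ℤ) (i : ℕ) : G.filtration p i ≤ G.filtration (p + 1) i := by
  by_cases hp : p < 0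
  · rw [G.filtration_eq_bot p i hp]
    exact bot_le
  by_cases hi : (i : ℤ) ≤ p + 1
  · rw [G.filtration_eq_top (p + 1) i hi]
    exact le_top
  obtain ⟨p, rfl⟩ := Int.eq_ofNat_of_zero_le (not_lt.1 hp)
  obtain ⟨q, rfl⟩ : ∃ q, i = p + (q + 1) := ⟨i - p - 1, by lia⟩
  intro x hx
  rw [G.mem_filtration_iff p (q + 1) _ rfl] at hx
  exact (G.mem_filtration_iff (p + 1) q _ (by lia) x).2 (step_succ_le q p _ (by lia) hx)

theorem isBoundedFiltration_filtration : IsBoundedFiltration G.complexRel G.filtration where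
  mono p q i h := monotone_int_of_le_succ (fun p => G.filtration_le_succ p i) h
  eq_bot := G.filtration_eq_bot
  eq_top := G.filtration_eq_top
  d_mem p i j x hx := by
    by_cases hj : j + 1 = i
    · subst hj
      by_cases hp : p < 0
      · rw [G.filtration_eq_bot p _ hp, Submodule.mem_bot] at hx
        rw [hx, map_zero]
        exact zero_mem _
      by_cases hi : (j : ℤ) ≤ p
      · rw [G.filtration_eq_top p j hi]
        trivial
      obtain ⟨p, rfl⟩ := Int.eq_ofNat_of_zero_le (not_lt.1 hp)
      obtain ⟨q, rfl⟩ : ∃ q, j = p + q := ⟨j - p, by lia⟩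
      refine (G.mem_filtration_iff p q _ rfl _).2 ?_
      rw [relVal_d]
      exact (G.lTensor_boundary q p (p + q + 1) (by lia) _
        ((G.mem_filtration_iff p (q + 1) _ (by lia) x).1 hx)).2
    · rw [G.complexRel.shape _ _ hj]
      exact zero_mem _

end Filtration

/-! ### The graded pieces of the relative complex -/

theorem exists_drVal_leftInverse (p : ℕ) :
    ∃ θ : tens k (DPow k m g) (LPow k m g) p →ₗ[k] G.complexDR.X p, ∀ v, θ (G.drVal p v) = v := by
  obtain ⟨θ, hθ⟩ := (G.drVal p).exists_leftInverse_of_injective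
    (LinearMap.ker_eq_bot.2 (G.drVal_injective p))
  exact ⟨θ, fun v => congrArg (fun f => f v) hθ⟩

/-- A linear retraction of `D ⊗ L^{⊗ p}` onto the kernel of its projection to `L^{⊗ (p+1)}`. -/
def drRetraction (p : ℕ) : tens k (DPow k m g) (LPow k m g) p →ₗ[k] G.complexDR.X p :=
  (G.exists_drVal_leftInverse p).choose

theorem drRetraction_drVal (p : ℕ) (v : G.complexDR.X p) :
    G.drRetraction p (G.drVal p v) = v :=
  (G.exists_drVal_leftInverse p).choose_spec v

/-- An element of `ker (D^{⊗ (p+1)} → L^{⊗ (p+1)})` has its image in `D ⊗ L^{⊗ p}` in the kernel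
of the projection to `L^{⊗ (p+1)}`. -/
theorem drVal_drRetraction (p : ℕ) (w : tens k (DPow k m g) (DPow k m g) p)
    (hw : tensMap (proj k m g) (proj k m g) p w = 0) :
    G.drVal p (G.drRetraction p (tensMap LinearMap.id (proj k m g) p w)) =
      tensMap LinearMap.id (proj k m g) p w := by
  obtain ⟨v, hv⟩ := G.exists_drVal_eq p (tensMap LinearMap.id (proj k m g) p w)
    (by rw [tensMap_tensMap, hw])
  rw [← hv, drRetraction_drVal]

theorem exists_tensMap_eq_drVal (p : ℕ) (v : G.complexDR.X p) :
    ∃ w, tensMap (proj k m g) (proj k m g) p w = 0 ∧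
      tensMap LinearMap.id (proj k m g) p w = G.drVal p v := by
  obtain ⟨w, hw⟩ := tensMap_surjective (LinearMap.id (R := k) (M := DPow k m g)) (proj k m g)
    Function.surjective_id proj_surjective p (G.drVal p v)
  refine ⟨w, ?_, hw⟩
  rw [← tensMap_tensMap, hw, tensMap_drVal]

/-- The projection of the filtration step `F_p` to its graded piece
`(g ⊗ D^{⊗ q}) ⊗ ker (D ⊗ L^{⊗ p} → L^{⊗ (p+1)})`, extended to the whole relative complex
by means of a retraction. -/
def gradedMap (p q : ℕ) :
    G.complexRel.X (p + q) →ₗ[k] (tens k g (DPow k m g) q) ⊗[k] (G.complexDR.X p) :=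
  (G.drRetraction p ∘ₗ tensMap LinearMap.id (proj k m g) p).lTensor (tens k g (DPow k m g) q) ∘ₗ
    (cat k g (DPow k m g) q p (p + q + 1) (by lia)).symm.toLinearMap ∘ₗ G.relVal (p + q)

theorem gradedMap_apply (p q : ℕ) (x : G.complexRel.X (p + q)) :
    G.gradedMap p q x = (G.drRetraction p).lTensor (tens k g (DPow k m g) q)
      ((tensMap LinearMap.id (proj k m g) p).lTensor (tens k g (DPow k m g) q)
        ((cat k g (DPow k m g) q p (p + q + 1) (by lia)).symm (G.relVal (p + q) x))) := by
  rw [← LinearMap.lTensor_comp_apply]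
  rfl

/-- On `F_p` the retraction loses no information. -/
theorem lTensor_drVal_gradedMap (p q : ℕ) (x : G.complexRel.X (p + q))
    (hx : x ∈ G.filtration p (p + q)) :
    (G.drVal p).lTensor (tens k g (DPow k m g) q) (G.gradedMap p q x) =
      (tensMap LinearMap.id (proj k m g) p).lTensor (tens k g (DPow k m g) q)
        ((cat k g (DPow k m g) q p (p + q + 1) (by lia)).symm (G.relVal (p + q) x)) := by
  rw [gradedMap_apply]
  rw [G.mem_filtration_iff p q _ rfl] at hx
  generalize G.relVal (p + q) x = y at hx
  refine step_le (S := LinearMap.eqLocus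
    ((G.drVal p).lTensor (tens k g (DPow k m g) q) ∘ₗ
      (G.drRetraction p).lTensor (tens k g (DPow k m g) q) ∘ₗ
      (tensMap LinearMap.id (proj k m g) p).lTensor (tens k g (DPow k m g) q) ∘ₗ
      (cat k g (DPow k m g) q p (p + q + 1) (by lia)).symm.toLinearMap)
    ((tensMap LinearMap.id (proj k m g) p).lTensor (tens k g (DPow k m g) q) ∘ₗ
      (cat k g (DPow k m g) q p (p + q + 1) (by lia)).symm.toLinearMap)) (fun a w hw => ?_) hx
  rw [LinearMap.mem_eqLocus]
  simp only [LinearMap.comp_apply, LinearEquiv.coe_coe, LinearEquiv.symm_apply_apply,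
    LinearMap.lTensor_tmul, G.drVal_drRetraction p w hw]

theorem gradedMap_eq_zero_iff (p q : ℕ) (x : G.complexRel.X (p + q))
    (hx : x ∈ G.filtration p (p + q)) :
    G.gradedMap p q x = 0 ↔ x ∈ G.filtration (p - 1) (p + q) := by
  have h1 : G.gradedMap p q x = 0 ↔
      (tensMap LinearMap.id (proj k m g) p).lTensor (tens k g (DPow k m g) q)
        ((cat k g (DPow k m g) q p (p + q + 1) (by lia)).symm (G.relVal (p + q) x)) = 0 := by
    constructor
    · intro h
      rw [← G.lTensor_drVal_gradedMap p q x hx, h, map_zero]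
    · intro h
      rw [gradedMap_apply, h, map_zero]
  rw [h1]
  cases p with
  | zero =>
    rw [G.filtration_eq_bot _ _ (by lia), Submodule.mem_bot]
    have h0 : Function.Injective (tensMap (LinearMap.id (R := k) (M := DPow k m g))
        (proj k m g) 0) := fun _ _ h => h
    rw [LinearMap.map_eq_zero_iff _ (Module.Flat.lTensor_preserves_injective_linearMap _ h0),
      LinearEquiv.map_eq_zero_iff]
    exact (G.relVal (0 + q)).map_eq_zero_iff (G.relVal_injective _)
  | succ p =>
    rw [show ((p + 1 : ℕ) : ℤ) - 1 = p by push_cast; ring,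
      G.mem_filtration_iff p (q + 1) _ (by lia)]
    exact (mem_step_succ_iff q p _ (by lia) _).symm

theorem exists_relVal_eq_cat (p q : ℕ) (a : tens k g (DPow k m g) q) (v : G.complexDR.X p)
    (w : tens k (DPow k m g) (DPow k m g) p) (hw : tensMap (proj k m g) (proj k m g) p w = 0)
    (hv : tensMap LinearMap.id (proj k m g) p w = G.drVal p v) :
    ∃ x ∈ G.filtration p (p + q), G.relVal (p + q) x =
      cat k g (DPow k m g) q p (p + q + 1) (by lia) (a ⊗ₜ w) ∧ G.gradedMap p q x = a ⊗ₜ v := by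
  have hmem := tmul_mem_step (N := p + q + 1) (hN := by lia) a hw
  obtain ⟨x, hx⟩ := G.exists_relVal_eq _ _ (step_le_ker q p _ _ hmem)
  refine ⟨x, (G.mem_filtration_iff p q _ rfl x).2 (hx ▸ hmem), hx, ?_⟩
  rw [gradedMap_apply, hx, LinearEquiv.symm_apply_apply, LinearMap.lTensor_tmul,
    LinearMap.lTensor_tmul, hv, drRetraction_drVal]

theorem exists_gradedMap_eq (p q : ℕ) (t : (tens k g (DPow k m g) q) ⊗[k] (G.complexDR.X p)) :
    ∃ x ∈ G.filtration p (p + q), G.gradedMap p q x = t := by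
  induction t using TensorProduct.induction_on with
  | zero => exact ⟨0, zero_mem _, map_zero _⟩
  | add a b ha hb =>
    obtain ⟨x, hx, rfl⟩ := ha
    obtain ⟨y, hy, rfl⟩ := hb
    exact ⟨x + y, add_mem hx hy, map_add _ _ _⟩
  | tmul a v =>
    obtain ⟨w, hw, hv⟩ := G.exists_tensMap_eq_drVal p v
    obtain ⟨x, hx, _, hxv⟩ := G.exists_relVal_eq_cat p q a v w hw hv
    exact ⟨x, hx, hxv⟩

theorem gradedMap_d (p q : ℕ) (x : G.complexRel.X (p + (q + 1)))
    (hx : x ∈ G.filtration p (p + (q + 1))) :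
    G.gradedMap p q ((G.complexRel.d (p + (q + 1)) (p + q)).hom x) =
      (boundary G.coRepD q).rTensor (G.complexDR.X p) (G.gradedMap p (q + 1) x) := by
  rw [G.mem_filtration_iff p (q + 1) _ rfl] at hx
  have h1 := (G.lTensor_boundary q p (p + q + 1) (by lia) _ hx).1
  have h2 := G.relVal_d (p + q) x
  rw [gradedMap_apply, gradedMap_apply]
  refine (congrArg (fun y => (G.drRetraction p).lTensor (tens k g (DPow k m g) q)
      ((tensMap LinearMap.id (proj k m g) p).lTensor (tens k g (DPow k m g) q)
        ((cat k g (DPow k m g) q p (p + q + 1) (by lia)).symm y))) h2).trans ?_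
  refine (congrArg ((G.drRetraction p).lTensor (tens k g (DPow k m g) q)) h1).trans ?_
  rw [← LinearMap.comp_apply, LinearMap.lTensor_comp_rTensor,
    ← LinearMap.rTensor_comp_lTensor]
  rfl

theorem catBoundary_eq_zero_of_d (s r N : ℕ) (hN : s + r = N) (a : tens k g (DPow k m g) s)
    (ha : (G.complexHL.d s (s - 1)).hom a = 0) (w : tens k (DPow k m g) (DPow k m g) r) :
    catBoundary G.coRepD s r N hN (a ⊗ₜ w) = 0 := by
  cases s with
  | zero => rfl
  | succ s =>
    have h0 : boundary G.coRepD s a = 0 := by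
      rw [← complexHL_d]
      exact ha
    rw [catBoundary, LinearMap.comp_apply, LinearMap.rTensor_tmul, h0, TensorProduct.zero_tmul,
      map_zero]

/-- `D` acts trivially on the homology of `CL_*(D, g)`: up to a sign, `[b, a]` is the boundary
of `a ⊗ b` for each cycle `a`. -/
theorem map_leftAct_eq_zero {Y : Type u} [AddCommGroup Y] [Module k Y] (q : ℕ)
    (a : tens k g (DPow k m g) q) (ha : (G.complexHL.d q (q - 1)).hom a = 0)
    (ρ : tens k g (DPow k m g) q →ₗ[k] Y) (hρ : ∀ y, ρ (boundary G.coRepD q y) = 0)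
    (b : DPow k m g) : ρ (leftAct G.coRepD q b a) = 0 := by
  have h1 := boundary_cat_zero G.coRepD q a b
  rw [G.catBoundary_eq_zero_of_d q 0 q rfl a ha, zero_add] at h1
  have h2 := hρ (snoc k g (DPow k m g) q a b)
  rw [h1, map_smul] at h2
  exact (smul_eq_zero.1 h2).resolve_left (pow_ne_zero _ (neg_ne_zero.2 one_ne_zero))

/-- The differential of `E¹` on `a ⊗ v`, with `a` a cycle. -/
theorem rTensor_gradedMap_d_tmul {Y : Type u} [AddCommGroup Y] [Module k Y] (p q i : ℕ)
    (hi : i = p + q + 1) (a : tens k g (DPow k m g) q)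
    (ha : (G.complexHL.d q (q - 1)).hom a = 0)
    (v : G.complexDR.X (p + 1)) (w : tens k (DPow k m g) (DPow k m g) (p + 1))
    (hv : tensMap LinearMap.id (proj k m g) (p + 1) w = G.drVal (p + 1) v)
    (x : G.complexRel.X i)
    (hx : G.relVal i x = cat k g (DPow k m g) q (p + 1) (i + 1) (by lia) (a ⊗ₜ w))
    (ρ : tens k g (DPow k m g) q →ₗ[k] Y) (hρ : ∀ y, ρ (boundary G.coRepD q y) = 0) :
    ρ.rTensor (G.complexDR.X p) (G.gradedMap p q ((G.complexRel.d i (p + q)).hom x)) =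
      (-1 : k) ^ (q + 1) • ρ a ⊗ₜ[k] (G.complexDR.d (p + 1) p).hom v := by
  subst hi
  have h1 : G.relVal (p + q) ((G.complexRel.d (p + q + 1) (p + q)).hom x) =
      (-1 : k) ^ (q + 1) • cat k g (DPow k m g) q p (p + q + 1) (by lia)
        (actSum ((leftAct G.coRepD q).flip a) p w +
          a ⊗ₜ boundary (adjointCoRep G.leibnizD) p w) := by
    rw [relVal_d, hx, boundary_cat_succ G.coRepD q p (p + q + 1) (by lia),
      G.catBoundary_eq_zero_of_d q _ _ _ a ha, zero_add]
  have h2 : G.drRetraction p (tensMap LinearMap.id (proj k m g) p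
      (boundary (adjointCoRep G.leibnizD) p w)) = (G.complexDR.d (p + 1) p).hom v := by
    rw [tensMap_id_boundary, hv, ← drVal_d, drRetraction_drVal]
  have h3 : ρ.rTensor (G.complexDR.X p) ((G.drRetraction p).lTensor _
      ((tensMap LinearMap.id (proj k m g) p).lTensor _
        (actSum ((leftAct G.coRepD q).flip a) p w))) = 0 := by
    have h4 := rTensor_actSum_eq_zero ((leftAct G.coRepD q).flip a) ρ
      (fun b => G.map_leftAct_eq_zero q a ha ρ hρ b) p w
    rw [← LinearMap.lTensor_comp_apply, ← LinearMap.comp_apply,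
      LinearMap.rTensor_comp_lTensor, ← LinearMap.lTensor_comp_rTensor, LinearMap.comp_apply,
      h4, map_zero]
  rw [gradedMap_apply, h1, map_smul, LinearEquiv.symm_apply_apply, map_smul, map_smul, map_smul,
    map_add, map_add, map_add, h3, zero_add, LinearMap.lTensor_tmul, LinearMap.lTensor_tmul, h2,
    LinearMap.rTensor_tmul]

/-- The graded pieces of the relative complex are the tensor products
`CL_q(D, g) ⊗ DR_p`. -/
def tensorGrading : TensorGrading G.complexRel G.filtration G.complexHL G.complexDR where
  gr := G.gradedMap
  sign q := (-1) ^ (q + 1)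
  sign_ne_zero _ := pow_ne_zero _ (neg_ne_zero.2 one_ne_zero)
  surjective := G.exists_gradedMap_eq
  gr_eq_zero_iff := G.gradedMap_eq_zero_iff
  gr_d p q x hx := by
    rw [complexHL_d]
    exact G.gradedMap_d p q x hx
  exists_lift p q a v ha := by
    obtain ⟨w, hw, hv⟩ := G.exists_tensMap_eq_drVal (p + 1) v
    obtain ⟨x, hx, hxw, hxv⟩ := G.exists_relVal_eq_cat (p + 1) q a v w hw hv
    refine ⟨x, hx, hxv, fun ρ hρ => ?_⟩
    rw [complexHL_d] at hρ
    exact G.rTensor_gradedMap_d_tmul p q _ (by lia) a ha v w hv x hxw ρ hρ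

end FilippovAlgebra

end LeibnizHomology

end

theorem theorem3p4 {k : Type u} [Field k] (hchar : ringChar k ≠ 2)
    {g : Type u} [AddCommGroup g] [Module k g]
    (m : ℕ) (hn : 2 < m + 1) (G : FilippovAlgebra k m g)
    (hdim : ((m + 1 : ℕ) : Cardinal.{u}) ≤ Module.rank k g) :
    IsBoundedFiltration G.complexRel G.filtration ∧
    ∃ E : HomologicalSpectralSequence.{u} k,
      Nonempty (SpectralSequenceOfFiltration G.complexRel G.filtration E) ∧
      ConvergesTo E (fun i => G.complexRel.homology i)
        (homologyFiltration G.complexRel G.filtration) ∧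
      ∀ r s : ℕ, Nonempty ((E.page 2 zero_le_two).X (r, s) ≃ₗ[k]
        ((G.complexHL.homology s : ModuleCat.{u} k) ⊗[k]
          (G.complexDR.homology r : ModuleCat.{u} k))) :=
  have hF := G.isBoundedFiltration_filtration
  ⟨hF, filteredSpectralSequence _ _ hF, ⟨filteredSpectralSequenceClass _ _ hF⟩,
    convergesTo_homologyFiltration hF, fun r s => G.tensorGrading.nonempty_page_two_equiv hF r s⟩
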